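/- Let $q$ be an odd prime power, let $t\ge 0$ be an integer, and put $m=4t+2$ and $n=q^m+1$. Let $\beta$ be a primitive $n$-th root of unity in an extension field of $\mathbb{F}_q$, and let $m_i(x)$ be the minimal polynomial of $\beta^i$ over $\mathbb{F}_q$. For integers $b\ge 0$ and $\delta\ge 1$ let $\mathcal{C}_{(n,q,\delta,b)}$ be the cyclic code of length $n$ over $\mathbb{F}_q$ with generator polynomial $\mathrm{lcm}(m_b(x),m_{b+1}(x),\ldots,m_{b+\delta-2}(x))$ (the empty lcm, for $\delta=1$, being $1$). For $0\le s\le n-1$ the $q$-cyclotomic coset of $s$ modulo $n$ is $C_s=\{sq^i \bmod n: i\ge 0\}\subseteq\{0,\ldots,n-1\}$, its smallest element is called a coset leader, and $\delta_{i,n}$ denotes the $i$-th largest coset leader modulo $n$. A linear code $\mathcal{C}\subseteq\mathbb{F}_q^n$ has parameters $[n,k,\ge d]$ if it has dimension $k$ and minimum Hamming distance at least $d$, and it is LCD if $\mathcal{C}\cap\mathcal{C}^{\perp}=\{0\}$, where $\mathcal{C}^{\perp}$ is the Euclidean dual. Then: (1) $\mathcal{C}_{(n,q,\delta,1)}$ is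 an LCD code with parameters $[n,6,\ge\delta_{3,n}]$ if $\delta_{3,n}+1\le\delta\le\delta_{2,n}$, and an LCD code with parameters $[n,2m+6,\ge\delta_{4,n}]$ if $\delta_{4,n}+1\le\delta\le\delta_{3,n}$. (2) $\mathcal{C}_{(n,q,\delta+1,0)}$ is an LCD code with parameters $[n,5,\ge2\delta_{3,n}]$ if $\delta_{3,n}+1\le\delta\le\delta_{2,n}$, and an LCD code with parameters $[n,2m+5,\ge2\delta_{4,n}]$ if $\delta_{4,n}+1\le\delta\le\delta_{3,n}$. -/

import Mathlib

namespace BCH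

/-- The `q`-cyclotomic coset `{s q ^ i mod n : 0 ≤ i ≤ l - 1}` modulo `n`, where `l` is the
multiplicative order of `q` modulo `n`. -/
noncomputable def cyclotomicCoset (q n s : ℕ) : Finset ℕ :=
  (Finset.range (orderOf (q : ZMod n))).image fun i => s * q ^ i % n

/-- The coset leader of the coset of `s`: its least element. -/
noncomputable def cosetLeader (q n s : ℕ) : ℕ :=
  sInf (cyclotomicCoset q n s : Set ℕ)

/-- The set of all coset leaders modulo `n`. -/
noncomputable def minRep (q n : ℕ) : Finset ℕ :=
  (Finset.range n).image fun s => cosetLeader q n s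

/-- `leader q n i`, for `i ≥ 1`, is the `i`-th largest coset leader modulo `n`: the largest coset
leader that is smaller than the previous one. The recursion starts at `n`, which is larger than
every coset leader. -/
noncomputable def leader (q n : ℕ) : ℕ → ℕ
  | 0 => n
  | i + 1 => ((minRep q n).filter fun a => a < leader q n i).sup id

section Codes

variable {F : Type*} [Field F]

/-- The minimum Hamming distance between two distinct codewords. -/
noncomputable def minDist [DecidableEq F] {n : ℕ} (C : Submodule F (Fin n → F)) : ℕ :=
  sInf {d | ∃ x ∈ C, ∃ y ∈ C, x ≠ y ∧ hammingDist x y = d}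

/-- `C` has parameters `[n, k, ≥ d]`: it has length `n`, dimension `k`, and minimum distance at
least `d`. -/
def HasParams [DecidableEq F] {n : ℕ} (C : Submodule F (Fin n → F)) (k d : ℕ) : Prop :=
  Module.finrank F C = k ∧ d ≤ minDist C

/-- The Euclidean dual code. -/
def dualCode {n : ℕ} (C : Submodule F (Fin n → F)) : Submodule F (Fin n → F) where
  carrier := {b | ∀ c ∈ C, b ⬝ᵥ c = 0}
  add_mem' := fun ha hb c hc => by rw [add_dotProduct, ha c hc, hb c hc, add_zero]
  zero_mem' := fun c _ => zero_dotProduct c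
  smul_mem' := fun r a ha c hc => by rw [smul_dotProduct, ha c hc, smul_zero]

/-- A linear code with complementary dual. -/
def IsLCD {n : ℕ} (C : Submodule F (Fin n → F)) : Prop :=
  C ⊓ dualCode C = ⊥

/-- The identification of the vector `(c₀, …, c_{n-1})` with the class of
`c₀ + c₁ x + ⋯ + c_{n-1} x ^ (n-1)` in `F[x] / (x ^ n - 1)`. -/
noncomputable def vecToQuot (F : Type*) [Field F] (n : ℕ) :
    (Fin n → F) →ₗ[F] AdjoinRoot (Polynomial.X ^ n - 1 : Polynomial F) :=
  Fintype.linearCombination F fun i : Fin n =>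
    AdjoinRoot.root (Polynomial.X ^ n - 1 : Polynomial F) ^ (i : ℕ)

/-- The cyclic code of length `n` corresponding to the ideal of `F[x] / (x ^ n - 1)` generated
by `g`. -/
noncomputable def cyclicCode (n : ℕ) (g : Polynomial F) : Submodule F (Fin n → F) :=
  ((Ideal.span {AdjoinRoot.mk (Polynomial.X ^ n - 1 : Polynomial F) g}).restrictScalars F).comap
    (vecToQuot F n)

/-- The polynomial `lcm (m_b, m_{b+1}, …, m_{b+δ-2})`, where `m_i` is the minimal polynomial of
`β ^ i` over `F`. -/
noncomputable def genPoly (F : Type*) [Field F] [DecidableEq F] {E : Type*} [Field E]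
    [Algebra F E] (β : E) (δ b : ℕ) : Polynomial F :=
  (Finset.range (δ - 1)).lcm fun j => minpoly F (β ^ (b + j))

/-- The BCH code of length `n` and designed distance `δ` over `F` with respect to the primitive
`n`-th root of unity `β`, whose zeros start at `β ^ b`. -/
noncomputable def bchCode (F : Type*) [Field F] [DecidableEq F] {E : Type*} [Field E]
    [Algebra F E] (β : E) (n δ b : ℕ) : Submodule F (Fin n → F) :=
  cyclicCode n (genPoly F β δ b)

end Codes

end BCH

/-! Everything reduces to the three largest coset leaders modulo n: their cosets have sizes 1, 4 and
2m.

Put h = n/2. Since q is odd, hq ≡ h, so on v = s - h multiplication by q is still v ↦ qv. Since q^m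
≡ -1, orbits are symmetric under v ↦ -v, so the leader of the coset of h + v is h minus the largest
absolute value in the orbit of v. Large leaders are thus orbits that stay close to 0. The closest is
v = 0. With a = n/(q²+1), the next is {±a, ±qa}, because q²a ≡ -a.

For t ≥ 1 the third orbit is that of qa - η, with η = (q-1)²(q²-1), and its largest absolute value
is at most qa + Z, where Z = (q-1)²w and w = (q^(4t-2)+1)/(q²+1). Conversely, suppose all absolute
values in a nonzero orbit are below qa + Z. They lie alternately above and below n/(q+1). Writing
the upper ones as qa + z, two steps act by z ↦ -Qz or z ↦ Qz + c, where Q = q² and c = (q-1)²a. The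
period of z divides m/2 = 2t+1, which is odd; this is where m ≡ 2 (mod 4) enters.
`exists_eq_zero_of_orbit` then forces z = 0 somewhere, so the orbit is that of qa. The constants
describe the extremal cycle -η, Qη, …, -Q^(2t-2)η, Z, -QZ of length 2t+1. The case t = 0 is done by
hand in `topCosets_two`.

For the codes, dimension counts the exponents that are not zeros: those with leader ≥ δ, together
with s = 0 when the zeros start at β. This gives 1 + 4 or 1 + 4 + 2m, plus one for b = 1. Again
because q^m ≡ -1, the zeros are closed under inversion. This makes the codes LCD, and for b = 0 it
nearly doubles the run of consecutive zeros in the BCH bound. -/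

/-! ### Periodic orbits of a two-branch integer map -/

namespace BCH

/-- A bounded periodic orbit, of odd period, of the two-branch map `z ↦ -Q z` or `z ↦ Q z + c`
passes through `0`. -/
theorem exists_eq_zero_of_orbit {t : ℕ} (ht : 1 ≤ t) {Q c Z η : ℤ} (hQ : 2 ≤ Q) (hη : 0 < η)
    (hc₁ : c = Q ^ 2 * Z - η) (hc₂ : c = Z + Q ^ (2 * t - 1) * η) (hc₃ : c < Q ^ (2 * t + 1) - 1)
    {z : ℕ → ℤ} (hper : ∀ k, z (k + (2 * t + 1)) = z k)
    (hstep : ∀ k, z (k + 1) = -Q * z k ∨ z (k + 1) = Q * z k + c)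
    (hlt : ∀ k, z k < Z) (hgt : ∀ k, -c < (Q - 1) * z k) : ∃ k, z k = 0 := by
  by_contra! hne
  obtain ⟨s, rfl⟩ : ∃ s, t = s + 1 := ⟨t - 1, by omega⟩
  have hP : Q ^ (2 * (s + 1) - 1) = Q * Q ^ (2 * s) := by
    rw [show 2 * (s + 1) - 1 = 2 * s + 1 by omega, pow_succ]; ring
  rw [hP] at hc₂
  -- the minimum is reached by a step of the first kind
  have hlow : ∀ k, -Q * Z < z k := by
    have hbdd : ∃ j, ∀ k, z j ≤ z k := by
      obtain ⟨j, -, hj⟩ := Finset.exists_min_image (Finset.range (2 * (s + 1) + 1)) z ⟨0, by simp⟩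
      refine ⟨j, fun k => ?_⟩
      have : Function.Periodic z (2 * (s + 1) + 1) := hper
      rw [← this.map_mod_nat k]
      exact hj _ (Finset.mem_range.2 (Nat.mod_lt _ (by omega)))
    obtain ⟨j, hj⟩ := hbdd
    intro k
    refine lt_of_lt_of_le ?_ (hj k)
    rw [← hper j, show j + (2 * (s + 1) + 1) = (j + 2 * (s + 1)) + 1 by omega]
    rcases hstep (j + 2 * (s + 1)) with h | h
    · rw [h]; nlinarith [hlt (j + 2 * (s + 1))]
    · exfalso
      rw [show j + 2 * (s + 1) + 1 = j + (2 * (s + 1) + 1) by omega, hper] at h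
      nlinarith [hj (j + 2 * (s + 1)), hgt (j + 2 * (s + 1))]
  -- The two expressions for c say that the second branch sends -Q^(2t-2)η to Z and -QZ to -η, so z
  -- < Z and z > -QZ confine both ends of such a step.
  have hL : ∀ k, z (k + 1) = Q * z k + c → z k < -(η * Q ^ (2 * s)) := by
    intro k hk
    have := hlt (k + 1)
    rw [hk, hc₂] at this
    by_contra! hcon
    nlinarith
  have hL' : ∀ k, z (k + 1) = Q * z k + c → -η < z (k + 1) := by
    intro k hk
    rw [hk, hc₁]
    nlinarith [hlow k]
  have hpos : 0 < η * Q ^ (2 * s) := by positivity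
  -- some step preserves the sign
  obtain ⟨k, hk, hk1⟩ : ∃ k, z (k + 1) = Q * z k + c ∧ z (k + 1) < 0 := by
    by_contra! hcon
    -- Otherwise every step reverses the sign, which is impossible along a cycle of odd length.
    have flip : ∀ k, 0 < z (k + 1) ↔ z k < 0 := by
      intro k
      rcases hstep k with h | h
      · rw [h]
        constructor
        · intro h'; by_contra! h2; nlinarith
        · intro h'; nlinarith
      · have h1 := hL k h
        have h2 := hcon k h
        have h3 := hne (k + 1)
        constructor
        · intro; omega
        · intro; omega
    have key : ∀ i k, 0 < z (k + 2 * i + 1) ↔ z k < 0 := by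
      intro i
      induction i with
      | zero => intro k; simpa using flip k
      | succ i ih =>
        intro k
        rw [show k + 2 * (i + 1) + 1 = (k + 2) + 2 * i + 1 by ring, ih]
        have h1 := flip (k + 1)
        have h2 := flip k
        have h3 := hne (k + 1)
        have h4 := hne k
        have h5 := hne (k + 2)
        rw [show k + 1 + 1 = k + 2 by ring] at h1
        omega
    have h1 := key (s + 1) 0
    rw [show 0 + 2 * (s + 1) + 1 = 0 + (2 * (s + 1) + 1) by ring, hper] at h1
    have h2 := hne 0
    omega
  have hk2 := hL' k hk
  -- Starting in (-η, 0), the first-branch values stay above -Q^(2t-2)η for all j ≤ 2t-1, so by `hL`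
  -- the second branch is unavailable.
  have run : ∀ j, j ≤ 2 * (s + 1) → z (k + 1 + j) = (-Q) ^ j * z (k + 1) := by
    intro j
    induction j with
    | zero => simp
    | succ j ih =>
      intro hj
      have ih := ih (by omega)
      rcases hstep (k + 1 + j) with h | h
      · rw [← add_assoc, h, ih]; ring
      · exfalso
        have h1 := hL _ h
        rw [ih] at h1
        rcases Nat.even_or_odd j with he | ho
        · rw [he.neg_pow] at h1
          have : Q ^ j ≤ Q ^ (2 * s) :=
            pow_le_pow_right₀ (by omega) (by obtain ⟨r, hr⟩ := he; omega)
          have h0 : 0 < Q ^ j := by positivity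
          nlinarith
        · rw [ho.neg_pow] at h1
          have h0 : 0 < Q ^ j := by positivity
          nlinarith
  have h1 := run (2 * (s + 1)) le_rfl
  rw [show k + 1 + 2 * (s + 1) = k + (2 * (s + 1) + 1) by ring, hper,
    (even_two_mul (s + 1)).neg_pow] at h1
  -- The cycle closes with z (k+1) = Q^(2t+1) z (k+1) + c. As z (k+1) ≤ -1, this gives c ≥ Q^(2t+1)
  -- - 1.
  rw [h1] at hk
  have h0 : 1 < Q ^ (2 * (s + 1) + 1) := one_lt_pow₀ (by omega) (by omega)
  rw [pow_succ] at hc₃ h0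
  nlinarith

end BCH

/-! ### Orbits of multiplication by q with small absolute values -/

namespace BCH

set_option maxHeartbeats 1000000 in
/-- Bounded orbits of multiplication by `q` modulo `n = q ^ (4t+2) + 1`, up to sign: if all the
absolute values are less than `q a + (q-1)² w`, the orbit contains `q a`, where
`a = n / (q² + 1)` and `w = (q ^ (4t-2) + 1) / (q² + 1)`. -/
theorem exists_eq_of_orbit_lt {t : ℕ} (ht : 1 ≤ t) {q w a n : ℤ} (hq : 3 ≤ q)
    (hw : (q ^ 2) ^ (2 * t - 1) + 1 = (q ^ 2 + 1) * w) (ha : a = q ^ 4 * w - q ^ 2 + 1)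
    (hn : n = (q ^ 2 + 1) * a) (hdvd : ¬ (q + 1) ∣ n) {x : ℕ → ℤ} (hpos : ∀ i, 0 < x i)
    (hper : ∀ i, x (i + 2 * (2 * t + 1)) = x i)
    (hstep : ∀ i, n ∣ q * x i - x (i + 1) ∨ n ∣ q * x i + x (i + 1))
    (hlt : ∀ i, x i < q * a + (q - 1) ^ 2 * w) : ∃ i, x i = q * a := by
  have hw1 : 1 ≤ w := by
    have : 0 < (q ^ 2) ^ (2 * t - 1) + 1 := by positivity
    rw [hw] at this
    exact pos_of_mul_pos_right this (by positivity)
  set Z := (q - 1) ^ 2 * w with hZ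
  have hZpos : 0 < Z := by
    have : 0 < (q - 1) := by omega
    positivity
  have hqZ : q * Z < a := by
    have : q * Z = (q ^ 3 - 2 * q ^ 2 + q) * w := by rw [hZ]; ring
    rw [this, ha]
    have h1 : q ^ 3 + q ^ 2 ≤ q ^ 4 := by nlinarith [pow_pos (show 0 < q by omega) 2]
    nlinarith [mul_le_mul_of_nonneg_right h1 (show 0 ≤ w by omega)]
  have hapos : 0 < a := by nlinarith
  have hnpos : 0 < n := by rw [hn]; positivity
  have hqM : q * (q * a + Z) < n := by rw [hn]; nlinarith
  have hstep' : ∀ i, x (i + 1) = q * x i ∨ x (i + 1) = n - q * x i := by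
    intro i
    have h1 := hlt i
    have h2 := hlt (i + 1)
    have h3 := hpos i
    have h4 := hpos (i + 1)
    have h5 : q * x i < n := by nlinarith
    have h6 : x (i + 1) < n := by nlinarith
    have h7 : 0 < q * x i := by positivity
    rcases hstep i with h | h
    · left
      have := Int.eq_zero_of_abs_lt_dvd h (by rw [abs_lt]; constructor <;> linarith)
      linarith
    · right
      obtain ⟨k, hk⟩ := h
      have : 0 < k := by
        by_contra! hk0
        nlinarith
      have : k < 2 := by
        by_contra! hk0
        nlinarith
      obtain rfl : k = 1 := by omega
      linarith
  -- The minimum cannot arise from x ↦ qx, so it is n - qx for some x < qa + Z, and n - q(qa + Z) =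
  -- a - qZ.
  have hlow : ∀ i, a - q * Z < x i := by
    obtain ⟨j, -, hj⟩ := Finset.exists_min_image (Finset.range (2 * (2 * t + 1))) x ⟨0, by simp⟩
    have hP : Function.Periodic x (2 * (2 * t + 1)) := hper
    have hj : ∀ k, x j ≤ x k := fun k => by
      rw [← hP.map_mod_nat k]
      exact hj _ (Finset.mem_range.2 (Nat.mod_lt _ (by omega)))
    intro i
    refine lt_of_lt_of_le ?_ (hj i)
    have h1 := hstep' (j + 4 * t + 1)
    rw [show j + 4 * t + 1 + 1 = j + 2 * (2 * t + 1) by ring, hper] at h1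
    have h2 := hj (j + 4 * t + 1)
    have h3 := hpos (j + 4 * t + 1)
    have h4 := hlt (j + 4 * t + 1)
    rcases h1 with h | h
    · nlinarith
    · rw [h, hn]; nlinarith
  have hlow' : n < (q + 1) * (q * (a - q * Z)) := by
    have : (q + 1) * (q * (a - q * Z)) - n = (q - 1) * (q ^ 2 * (w - 1) + 1) := by
      rw [hn, hZ, ha]; ring
    have : 0 < (q - 1) * (q ^ 2 * (w - 1) + 1) := by
      have h1 : 0 < q - 1 := by omega
      have h2 : 0 ≤ w - 1 := by omega
      positivity
    linarith
  have hhigh : (q + 1) * (q * a + Z) < q * n := by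
    have h1 : (q + 1) * (q * a + Z) = (q + 1) * q * a + q * Z + Z := by ring
    have h2 : Z ≤ q * Z := by nlinarith
    rw [h1, hn]
    nlinarith [mul_pos hapos (show 0 < q by omega), mul_pos (mul_pos hapos (show 0 < q by omega))
      (show 0 < q - 2 by omega)]
  -- The threshold n/(q+1) is the fixed point of x ↦ n - qx, which therefore exchanges its two
  -- sides. From below, the branch qx lands above it by `hlow'`; from above, that branch would
  -- exceed qa + Z by `hhigh`.
  have up : ∀ i, (q + 1) * x i < n → n < (q + 1) * x (i + 1) := by
    intro i hi
    rcases hstep' i with h | h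
    · rw [h]; nlinarith [hlow i]
    · rw [h]; nlinarith
  have down : ∀ i, n < (q + 1) * x i → x (i + 1) = n - q * x i ∧ (q + 1) * x (i + 1) < n := by
    intro i hi
    rcases hstep' i with h | h
    · exfalso
      have := hlt (i + 1)
      rw [h] at this
      nlinarith
    · exact ⟨h, by rw [h]; nlinarith⟩
  obtain ⟨i₀, hi₀⟩ : ∃ i, n < (q + 1) * x i := by
    rcases lt_trichotomy ((q + 1) * x 0) n with h | h | h
    · exact ⟨1, up 0 h⟩
    · exact absurd ⟨_, h.symm⟩ hdvd
    · exact ⟨0, h⟩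
  have hup : ∀ k, n < (q + 1) * x (i₀ + 2 * k) := by
    intro k
    induction k with
    | zero => simpa using hi₀
    | succ k ih => exact up _ (down _ ih).2
  have hc : (q - 1) ^ 2 * a < (q ^ 2) ^ (2 * t + 1) - 1 := by
    have : (q ^ 2) ^ (2 * t + 1) = q ^ 4 * (q ^ 2) ^ (2 * t - 1) := by
      rw [show 2 * t + 1 = 2 * t - 1 + 2 by omega, pow_add]; ring
    rw [this, show (q ^ 2) ^ (2 * t - 1) = (q ^ 2 + 1) * w - 1 by linarith]
    have h1 : q ^ 4 * ((q ^ 2 + 1) * w - 1) - 1 = (q ^ 2 + 1) * a - 2 := by rw [ha]; ring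
    have h2 : (q ^ 2 + 1) * a - 2 - (q - 1) ^ 2 * a = 2 * (q * a) - 2 := by ring
    have h3 : 3 * 1 ≤ q * a := mul_le_mul hq (by omega) (by omega) (by omega)
    rw [h1]
    linarith
  -- Sampling only the upper times halves the period 4t+2 to the odd number 2t+1.
  obtain ⟨k, hk⟩ := exists_eq_zero_of_orbit ht (Q := q ^ 2) (c := (q - 1) ^ 2 * a) (Z := Z)
    (η := (q - 1) ^ 2 * (q ^ 2 - 1)) (z := fun k => x (i₀ + 2 * k) - q * a) (by nlinarith)
    (by have h1 : 0 < q - 1 := by omega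
        have h2 : 0 < q ^ 2 - 1 := by nlinarith
        exact mul_pos (pow_pos h1 2) h2)
    (by rw [hZ, ha]; ring)
    (by rw [hZ, ha, show (q ^ 2) ^ (2 * t - 1) = (q ^ 2 + 1) * w - 1 by linarith]; ring)
    hc
    (by intro k; rw [mul_add, ← add_assoc, hper])
    (by
      intro k
      have h1 := (down _ (hup k)).1
      rw [show i₀ + 2 * (k + 1) = i₀ + 2 * k + 1 + 1 by ring]
      rcases hstep' (i₀ + 2 * k + 1) with h | h
      · left; rw [h, h1, hn]; ring
      · right; rw [h, h1, hn]; ring)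
    (fun k => by have := hlt (i₀ + 2 * k); linarith)
    (by
      intro k
      have h1 := hup k
      rw [hn] at h1
      have h2 : 0 < (q - 1) * ((q + 1) * x (i₀ + 2 * k) - (q ^ 2 + 1) * a) :=
        mul_pos (by omega) (by linarith)
      nlinarith)
  exact ⟨_, by have : x (i₀ + 2 * k) - q * a = 0 := hk
               linarith⟩

end BCH

/-! ### Coset leaders and coset sizes -/

namespace BCH

section Coset

variable {q n : ℕ}

theorem orderOf_pos_of_isUnit (hq : IsUnit (q : ZMod n)) : 0 < orderOf (q : ZMod n) := by
  obtain ⟨u, hu⟩ := hq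
  rw [← hu, orderOf_units]
  exact orderOf_pos u

theorem cosetLeader_le {s a : ℕ} (ha : a ∈ cyclotomicCoset q n s) : cosetLeader q n s ≤ a :=
  Nat.sInf_le (Finset.mem_coe.2 ha)

theorem leader_lt (i : ℕ) (h : 0 < leader q n i) : leader q n (i + 1) < leader q n i := by
  rw [leader, Finset.sup_lt_iff h]
  intro b hb
  exact (Finset.mem_filter.1 hb).2

theorem cosetLeader_le_leader_succ {i s : ℕ} (hs : s < n)
    (h : cosetLeader q n s < leader q n i) : cosetLeader q n s ≤ leader q n (i + 1) := by
  rw [leader]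
  exact Finset.le_sup (f := id) (Finset.mem_filter.2
    ⟨Finset.mem_image.2 ⟨s, Finset.mem_range.2 hs, rfl⟩, h⟩)

theorem exists_pow_inverse (hq : IsUnit (q : ZMod n)) (i : ℕ) :
    ∃ j, (q : ZMod n) ^ i * (q : ZMod n) ^ j = 1 := by
  refine ⟨(orderOf (q : ZMod n) - 1) * i, ?_⟩
  have h := orderOf_pos_of_isUnit hq
  rw [← pow_add, show i + (orderOf (q : ZMod n) - 1) * i = orderOf (q : ZMod n) * i by
    obtain ⟨k, hk⟩ : ∃ k, orderOf (q : ZMod n) = k + 1 := ⟨_, (Nat.succ_pred_eq_of_pos h).symm⟩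
    rw [hk, Nat.add_sub_cancel]; ring, pow_mul, pow_orderOf_eq_one, one_pow]

theorem leader_succ_eq {i s : ℕ} (hs : s < n) (h : cosetLeader q n s < leader q n i)
    (hmax : ∀ a < n, cosetLeader q n a < leader q n i → cosetLeader q n a ≤ cosetLeader q n s) :
    leader q n (i + 1) = cosetLeader q n s := by
  refine le_antisymm ?_ (cosetLeader_le_leader_succ hs h)
  rw [leader, Finset.sup_le_iff]
  intro b hb
  obtain ⟨hb, hb'⟩ := Finset.mem_filter.1 hb
  obtain ⟨a, ha, rfl⟩ := Finset.mem_image.1 hb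
  exact hmax a (Finset.mem_range.1 ha) hb'

variable [NeZero n]

theorem mem_cyclotomicCoset (hq : IsUnit (q : ZMod n)) {s a : ℕ} :
    a ∈ cyclotomicCoset q n s ↔ a < n ∧ ∃ i, (a : ZMod n) = s * (q : ZMod n) ^ i := by
  simp only [cyclotomicCoset, Finset.mem_image, Finset.mem_range]
  constructor
  · rintro ⟨i, -, rfl⟩
    exact ⟨Nat.mod_lt _ (NeZero.pos n), i, by simp⟩
  · rintro ⟨ha, i, hi⟩
    refine ⟨i % orderOf (q : ZMod n), Nat.mod_lt _ (orderOf_pos_of_isUnit hq), ?_⟩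
    rw [← Nat.mod_eq_of_lt ha]
    refine (ZMod.natCast_eq_natCast_iff' _ _ _).1 ?_
    push_cast
    rw [pow_mod_orderOf, hi]

theorem cosetLeader_mem (hq : IsUnit (q : ZMod n)) (s : ℕ) :
    cosetLeader q n s ∈ cyclotomicCoset q n s := by
  have : (cyclotomicCoset q n s : Set ℕ).Nonempty :=
    ⟨s % n, Finset.mem_coe.2 <| (mem_cyclotomicCoset hq).2
      ⟨Nat.mod_lt _ (NeZero.pos n), 0, by simp⟩⟩
  exact Finset.mem_coe.1 (Nat.sInf_mem this)

theorem cosetLeader_lt (hq : IsUnit (q : ZMod n)) (s : ℕ) : cosetLeader q n s < n :=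
  ((mem_cyclotomicCoset hq).1 (cosetLeader_mem hq s)).1

theorem cosetLeader_eq_iff (hq : IsUnit (q : ZMod n)) {s s' : ℕ} :
    cosetLeader q n s' = cosetLeader q n s ↔ ∃ i, (s' : ZMod n) = s * (q : ZMod n) ^ i := by
  constructor
  · intro h
    obtain ⟨-, i, hi⟩ := (mem_cyclotomicCoset hq).1 (cosetLeader_mem hq s)
    obtain ⟨-, i', hi'⟩ := (mem_cyclotomicCoset hq).1 (cosetLeader_mem hq s')
    obtain ⟨j, hj⟩ := exists_pow_inverse hq i'
    rw [h, hi] at hi'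
    exact ⟨i + j, by rw [pow_add, ← mul_assoc, hi', mul_assoc, hj, mul_one]⟩
  · rintro ⟨i, hi⟩
    have : cyclotomicCoset q n s' = cyclotomicCoset q n s := by
      ext a
      rw [mem_cyclotomicCoset hq, mem_cyclotomicCoset hq]
      refine and_congr_right fun _ => ⟨?_, ?_⟩
      · rintro ⟨k, hk⟩
        exact ⟨i + k, by rw [hk, hi, pow_add, mul_assoc]⟩
      · rintro ⟨k, hk⟩
        obtain ⟨j, hj⟩ := exists_pow_inverse hq i
        exact ⟨j + k, by rw [hk, hi, pow_add, ← mul_assoc, mul_assoc (s : ZMod n), hj, mul_one]⟩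
    rw [cosetLeader, cosetLeader, this]

theorem cosetLeader_cosetLeader (hq : IsUnit (q : ZMod n)) (s : ℕ) :
    cosetLeader q n (cosetLeader q n s) = cosetLeader q n s := by
  obtain ⟨-, i, hi⟩ := (mem_cyclotomicCoset hq).1 (cosetLeader_mem hq s)
  exact (cosetLeader_eq_iff hq).2 ⟨i, hi⟩

theorem cosetLeader_le_self (hq : IsUnit (q : ZMod n)) {s : ℕ} (hs : s < n) :
    cosetLeader q n s ≤ s :=
  cosetLeader_le ((mem_cyclotomicCoset hq).2 ⟨hs, 0, by simp⟩)

theorem cosetLeader_eq_zero_iff (hq : IsUnit (q : ZMod n)) {s : ℕ} (hs : s < n) :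
    cosetLeader q n s = 0 ↔ s = 0 := by
  constructor
  · intro h
    obtain ⟨-, i, hi⟩ := (mem_cyclotomicCoset hq).1 (cosetLeader_mem hq s)
    rw [h, Nat.cast_zero] at hi
    have := (hq.pow i).mul_left_eq_zero.1 hi.symm
    exact Nat.eq_zero_of_dvd_of_lt ((ZMod.natCast_eq_zero_iff _ _).1 this) hs
  · rintro rfl
    exact Nat.le_zero.1 (cosetLeader_le_self hq hs)

theorem card_cosetLeader_eq (hq : IsUnit (q : ZMod n)) (s : ℕ) :
    ((Finset.range n).filter fun a => cosetLeader q n a = cosetLeader q n s).card =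
      Function.minimalPeriod (fun x : ZMod n => x * q) (s : ZMod n) := by
  set f := fun x : ZMod n => x * q
  have hf : ∀ i (x : ZMod n), f^[i] x = x * (q : ZMod n) ^ i := by
    intro i x
    rw [mul_right_iterate]
  have hpos : 0 < Function.minimalPeriod f (s : ZMod n) := by
    refine Function.IsPeriodicPt.minimalPeriod_pos (orderOf_pos_of_isUnit hq) ?_
    rw [Function.IsPeriodicPt, Function.IsFixedPt, hf, pow_orderOf_eq_one, mul_one]
  have : ((Finset.range n).filter fun a => cosetLeader q n a = cosetLeader q n s) =
      (Finset.range (Function.minimalPeriod f (s : ZMod n))).image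
        fun i => (f^[i] (s : ZMod n)).val := by
    ext a
    simp only [Finset.mem_filter, Finset.mem_range, Finset.mem_image, cosetLeader_eq_iff hq]
    constructor
    · rintro ⟨ha, i, hi⟩
      refine ⟨i % Function.minimalPeriod f (s : ZMod n), Nat.mod_lt _ hpos, ?_⟩
      rw [Function.iterate_mod_minimalPeriod_eq, hf, ← hi, ZMod.val_cast_of_lt ha]
    · rintro ⟨i, -, rfl⟩
      exact ⟨ZMod.val_lt _, i, by rw [ZMod.natCast_zmod_val, hf]⟩
  rw [this, Finset.card_image_of_injOn, Finset.card_range]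
  intro i hi j hj hij
  have := Function.iterate_injOn_Iio_minimalPeriod (f := f) (x := (s : ZMod n))
  exact this (by simpa using hi) (by simpa using hj) (ZMod.val_injective n hij)

/-- If the three largest coset leaders are known, then so are the sizes of the unions of the
cosets with large leaders. -/
theorem card_le_cosetLeader (hq : IsUnit (q : ZMod n)) {s₁ s₂ s₃ : ℕ} (h₁ : s₁ < n) (h₂ : s₂ < n)
    (h₃ : s₃ < n) (h₂₁ : cosetLeader q n s₂ < cosetLeader q n s₁)
    (h₃₂ : cosetLeader q n s₃ < cosetLeader q n s₂)
    (hmax : ∀ s < n, cosetLeader q n s = cosetLeader q n s₁ ∨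
      cosetLeader q n s = cosetLeader q n s₂ ∨ cosetLeader q n s ≤ cosetLeader q n s₃)
    (δ : ℕ) :
    (leader q n 3 < δ → δ ≤ leader q n 2 →
      ((Finset.range n).filter fun s => δ ≤ cosetLeader q n s).card =
        Function.minimalPeriod (fun x : ZMod n => x * q) (s₁ : ZMod n) +
        Function.minimalPeriod (fun x : ZMod n => x * q) (s₂ : ZMod n)) ∧
    (leader q n 4 < δ → δ ≤ leader q n 3 →
      ((Finset.range n).filter fun s => δ ≤ cosetLeader q n s).card =
        Function.minimalPeriod (fun x : ZMod n => x * q) (s₁ : ZMod n) +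
        Function.minimalPeriod (fun x : ZMod n => x * q) (s₂ : ZMod n) +
        Function.minimalPeriod (fun x : ZMod n => x * q) (s₃ : ZMod n)) := by
  have l₁ : leader q n 1 = cosetLeader q n s₁ :=
    leader_succ_eq h₁ (cosetLeader_lt hq _) fun s hs _ => by
      rcases hmax s hs with h | h | h <;> omega
  have l₂ : leader q n 2 = cosetLeader q n s₂ :=
    leader_succ_eq h₂ (by rw [l₁]; exact h₂₁) fun s hs h' => by
      rcases hmax s hs with h | h | h <;> omega
  have l₃ : leader q n 3 = cosetLeader q n s₃ :=
    leader_succ_eq h₃ (by rw [l₂]; exact h₃₂) fun s hs h' => by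
      rcases hmax s hs with h | h | h <;> omega
  rw [l₂, l₃]
  refine ⟨fun hδ hδ' => ?_, fun hδ hδ' => ?_⟩
  · rw [← card_cosetLeader_eq hq, ← card_cosetLeader_eq hq, ← Finset.card_union_of_disjoint]
    · congr 1
      ext s
      simp only [Finset.mem_filter, Finset.mem_range, Finset.mem_union, ← and_or_left]
      refine and_congr_right fun hs => ?_
      rcases hmax s hs with h | h | h <;> omega
    · rw [Finset.disjoint_left]
      intro s hs hs'
      simp only [Finset.mem_filter] at hs hs'
      omega
  · rw [← card_cosetLeader_eq hq, ← card_cosetLeader_eq hq, ← card_cosetLeader_eq hq,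
      ← Finset.card_union_of_disjoint, ← Finset.card_union_of_disjoint]
    · congr 1
      ext s
      simp only [Finset.mem_filter, Finset.mem_range, Finset.mem_union, ← and_or_left]
      refine and_congr_right fun hs => ?_
      -- The fourth leader need not be computed: any leader below the third is at most the fourth,
      -- hence less than δ.
      have := cosetLeader_le_leader_succ (i := 3) (q := q) hs
      rw [show 3 + 1 = 4 from rfl] at this
      rw [l₃] at this
      rcases hmax s hs with h | h | h <;> omega
    · rw [Finset.disjoint_left]
      intro s hs hs'
      simp only [Finset.mem_filter, Finset.mem_union] at hs hs'
      omega
    · rw [Finset.disjoint_left]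
      intro s hs hs'
      simp only [Finset.mem_filter] at hs hs'
      omega

end Coset

end BCH

/-! ### Centring at n / 2, and the case t = 0 -/

namespace BCH

section HalfShift

variable {q n m h : ℕ}

theorem half_mul_pow (hhq : (h : ZMod n) * q = h) (i : ℕ) : (h : ZMod n) * (q : ZMod n) ^ i = h := by
  induction i with
  | zero => simp
  | succ i ih => rw [pow_succ, ← mul_assoc, ih, hhq]

theorem minimalPeriod_half (hhq : (h : ZMod n) * q = h) :
    Function.minimalPeriod (fun x : ZMod n => x * q) (h : ZMod n) = 1 :=
  Function.minimalPeriod_eq_one_iff_isFixedPt.2 hhq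

theorem two_mul_half (hh : 2 * h = n) : 2 * (h : ZMod n) = 0 := by
  have : ((2 * h : ℕ) : ZMod n) = 0 := by rw [hh]; simp
  exact_mod_cast this

theorem isPeriodicPt_mul_right_iff (hhq : (h : ZMod n) * q = h) (s : ZMod n) (i : ℕ) :
    Function.IsPeriodicPt (fun x : ZMod n => x * q) i s ↔
      (s - h) * (q : ZMod n) ^ i = s - h := by
  rw [Function.IsPeriodicPt, Function.IsFixedPt, mul_right_iterate]
  dsimp only
  rw [sub_mul, half_mul_pow hhq, sub_left_inj]

variable [NeZero n]

/-- An element `h + v` of the coset of `s`, where `h = n / 2`, bounds the coset leader. -/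
theorem cosetLeader_le_half_sub (hq : IsUnit (q : ZMod n)) (hm : (q : ZMod n) ^ m = -1)
    (hh : 2 * h = n) (hhq : (h : ZMod n) * q = h) {s i : ℕ} {v : ℤ}
    (hv : (v : ZMod n) = ((s : ZMod n) - h) * (q : ZMod n) ^ i) (hvh : |v| ≤ h) :
    (cosetLeader q n s : ℤ) ≤ h - |v| := by
  have hn := NeZero.pos n
  obtain ⟨a, ha⟩ := Int.eq_ofNat_of_zero_le (sub_nonneg.2 hvh)
  have ha' : a < n := by have := abs_nonneg v; omega
  have hmem : a ∈ cyclotomicCoset q n s := by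
    refine (mem_cyclotomicCoset hq).2 ⟨ha', ?_⟩
    have hcast : (a : ZMod n) = ((h - |v| : ℤ) : ZMod n) := by rw [ha]; simp
    -- If v ≥ 0, then h - |v| = h - v is reached m steps later, because q^m = -1.
    rcases abs_choice v with hc | hc
    · refine ⟨i + m, ?_⟩
      rw [hcast, hc]
      push_cast
      rw [hv, pow_add, hm]
      linear_combination half_mul_pow hhq i + two_mul_half hh
    · refine ⟨i, ?_⟩
      rw [hcast, hc]
      push_cast
      rw [hv]
      linear_combination -half_mul_pow hhq i
  rw [ha]
  exact_mod_cast cosetLeader_le hmem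

/-- Since M < h, each h + v with |v| ≤ M lies strictly between 0 and n, so no reduction modulo n
occurs and the leader is itself such an h + v. -/
theorem half_sub_le_cosetLeader (hq : IsUnit (q : ZMod n)) (hh : 2 * h = n)
    (hhq : (h : ZMod n) * q = h) {s : ℕ} {M : ℤ} (hM : M < h)
    (hv : ∀ i, ∃ v : ℤ, |v| ≤ M ∧ (v : ZMod n) = ((s : ZMod n) - h) * (q : ZMod n) ^ i) :
    h - M ≤ (cosetLeader q n s : ℤ) := by
  obtain ⟨hlt, i, hi⟩ := (mem_cyclotomicCoset hq).1 (cosetLeader_mem hq s)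
  obtain ⟨v, hvM, hv⟩ := hv i
  rw [abs_le] at hvM
  have : ((cosetLeader q n s : ℤ) : ZMod n) = ((h + v : ℤ) : ZMod n) := by
    push_cast
    rw [hv, hi]
    linear_combination half_mul_pow hhq i
  rw [ZMod.intCast_eq_intCast_iff, Int.ModEq, Int.emod_eq_of_lt (by omega) (by omega),
    Int.emod_eq_of_lt (by omega) (by omega)] at this
  omega

theorem cosetLeader_half (hq : IsUnit (q : ZMod n)) (hh : 2 * h = n)
    (hhq : (h : ZMod n) * q = h) : cosetLeader q n h = h := by
  have hn := NeZero.pos n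
  refine le_antisymm (cosetLeader_le_self hq (by omega)) ?_
  have := half_sub_le_cosetLeader hq hh hhq (s := h) (M := 0) (by omega)
    fun i => ⟨0, by simp, by simp⟩
  omega

theorem eq_zero_or_half_of_two_mul (hh : 2 * h = n) {x : ZMod n} (hx : 2 * x = 0) :
    x = 0 ∨ x = h := by
  have hn := NeZero.pos n
  rw [← ZMod.natCast_zmod_val x] at hx ⊢
  have hlt := ZMod.val_lt x
  have : ((2 * x.val : ℕ) : ZMod n) = 0 := by exact_mod_cast hx
  rw [ZMod.natCast_eq_zero_iff] at this
  obtain ⟨k, hk⟩ := this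
  have : k < 2 := by by_contra! hc; nlinarith
  interval_cases k
  · left; simp [show x.val = 0 by omega]
  · right; rw [show x.val = h by omega]

/-- Every representative can be chosen of absolute value at most `n / 2`. -/
theorem exists_intCast_abs_le_half (hh : 2 * h = n) (x : ZMod n) :
    ((x.valMinAbs : ℤ) : ZMod n) = x ∧ |x.valMinAbs| ≤ h := by
  refine ⟨ZMod.coe_valMinAbs x, ?_⟩
  have := ZMod.natAbs_valMinAbs_le x
  rw [Int.abs_eq_natAbs]
  omega

end HalfShift

/-- The orbit of qa is contained in {±a, ±qa}, because q²a ≡ -a. -/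
theorem exists_abs_le_mul_pow {q n : ℕ} {a : ℤ} (hq : 1 ≤ q) (ha : 0 ≤ a)
    (hn : ((((q : ℤ) ^ 2 + 1) * a : ℤ) : ZMod n) = 0) (i : ℕ) :
    ∃ v : ℤ, |v| ≤ q * a ∧ (v : ZMod n) = ((q * a : ℤ) : ZMod n) * (q : ZMod n) ^ i := by
  have hqa : a ≤ q * a := by nlinarith
  suffices H : ∃ v : ℤ, (v = q * a ∨ v = -(q * a) ∨ v = a ∨ v = -a) ∧
      (v : ZMod n) = ((q * a : ℤ) : ZMod n) * (q : ZMod n) ^ i by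
    obtain ⟨v, hv, h⟩ := H
    exact ⟨v, by rw [abs_le]; omega, h⟩
  induction i with
  | zero => exact ⟨q * a, Or.inl rfl, by simp⟩
  | succ i ih =>
    obtain ⟨v, hv, h⟩ := ih
    push_cast at hn h ⊢
    rcases hv with rfl | rfl | rfl | rfl
    · refine ⟨-a, by simp, ?_⟩
      push_cast at h ⊢
      linear_combination (q : ZMod n) * h - hn
    · refine ⟨a, by simp, ?_⟩
      push_cast at h ⊢
      linear_combination (q : ZMod n) * h + hn
    · refine ⟨q * v, by simp, ?_⟩
      push_cast at h ⊢
      linear_combination (q : ZMod n) * h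
    · refine ⟨-(q * a), by simp, ?_⟩
      push_cast at h ⊢
      linear_combination (q : ZMod n) * h

/-- For `n = q ^ m + 1` with `m ≡ 2 (mod 4)`, the three largest coset leaders belong to cosets
of sizes `1`, `4` and `2 * m`. -/
def TopCosets (q n m : ℕ) : Prop :=
  ∃ s₁ s₂ s₃ : ℕ, s₁ < n ∧ s₂ < n ∧ s₃ < n ∧
    cosetLeader q n s₂ < cosetLeader q n s₁ ∧ cosetLeader q n s₃ < cosetLeader q n s₂ ∧
    (∀ s < n, cosetLeader q n s = cosetLeader q n s₁ ∨
      cosetLeader q n s = cosetLeader q n s₂ ∨ cosetLeader q n s ≤ cosetLeader q n s₃) ∧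
    Function.minimalPeriod (fun x : ZMod n => x * q) (s₁ : ZMod n) = 1 ∧
    Function.minimalPeriod (fun x : ZMod n => x * q) (s₂ : ZMod n) = 4 ∧
    Function.minimalPeriod (fun x : ZMod n => x * q) (s₃ : ZMod n) = 2 * m

theorem minimalPeriod_eq_four {q n h : ℕ} [NeZero n] (hh : 2 * h = n)
    (hhq : (h : ZMod n) * q = h) {s : ZMod n} (hs : (s - h) * (q : ZMod n) ^ 2 = -(s - h))
    (h0 : s ≠ 0) (h1 : s ≠ h) : Function.minimalPeriod (fun x : ZMod n => x * q) s = 4 := by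
  have : Fact (Nat.Prime 2) := ⟨Nat.prime_two⟩
  refine Function.minimalPeriod_eq_prime_pow (p := 2) (k := 1) ?_ ?_
  · rw [isPeriodicPt_mul_right_iff hhq, pow_one, hs]
    intro hc
    have : 2 * (s - h) = 0 := by linear_combination -hc
    rcases eq_zero_or_half_of_two_mul hh this with h' | h'
    · exact h1 (sub_eq_zero.1 h')
    · exact h0 (by linear_combination h' + two_mul_half hh)
  · rw [isPeriodicPt_mul_right_iff hhq]
    norm_num
    linear_combination ((q : ZMod n) ^ 2 - 1) * hs

/-- Here a = 1, and every residue other than 0 and h has orbit length 4 = 2m. The third coset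
therefore need not be identified: it exists because n ≥ 10 exceeds the six residues in {0, h} and
the coset of h + q. -/
theorem topCosets_two {q n : ℕ} (hq3 : 3 ≤ q) (hodd : Odd q) (hn : n = q ^ 2 + 1) :
    TopCosets q n 2 := by
  have : NeZero n := ⟨by omega⟩
  obtain ⟨r, hr⟩ := hodd
  obtain ⟨h, hh⟩ : ∃ h, 2 * h = n := ⟨2 * r ^ 2 + 2 * r + 1, by rw [hn, hr]; ring⟩
  have hm : (q : ZMod n) ^ 2 = -1 := by
    have : ((q ^ 2 + 1 : ℕ) : ZMod n) = 0 := by rw [← hn]; simp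
    push_cast at this
    linear_combination this
  have hq : IsUnit (q : ZMod n) := by
    refine IsUnit.of_mul_eq_one (-(q : ZMod n)) ?_
    linear_combination -hm
  have hhq : (h : ZMod n) * q = h := by
    rw [hr]; push_cast
    linear_combination (r : ZMod n) * two_mul_half hh
  have hqh : 2 * q < n - 3 := by
    rw [hn]
    have : 3 * q ≤ q ^ 2 := by nlinarith
    omega
  have hper : ∀ s : ℕ, s < n → s ≠ 0 → s ≠ h →
      Function.minimalPeriod (fun x : ZMod n => x * q) (s : ZMod n) = 4 := by
    intro s hs h0 h1
    refine minimalPeriod_eq_four hh hhq (by rw [hm]; ring) ?_ ?_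
    · rw [Ne, ZMod.natCast_eq_zero_iff]
      exact fun hc => h0 (Nat.eq_zero_of_dvd_of_lt hc hs)
    · intro hc
      have := congrArg ZMod.val hc
      rw [ZMod.val_cast_of_lt hs, ZMod.val_cast_of_lt (by omega)] at this
      exact h1 this
  have hle : ∀ s < n, s ≠ h → cosetLeader q n s ≤ h - q := by
    intro s hs h1
    obtain ⟨hv, hvh⟩ := exists_intCast_abs_le_half hh ((s : ZMod n) - h)
    set v := ((s : ZMod n) - h).valMinAbs with hvdef
    have hv0 : v ≠ 0 := by
      intro hc
      rw [hc, Int.cast_zero, eq_comm, sub_eq_zero] at hv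
      have := congrArg ZMod.val hv
      rw [ZMod.val_cast_of_lt hs, ZMod.val_cast_of_lt (by omega)] at this
      exact h1 this
    have hv1 : 1 ≤ |v| := Int.one_le_abs hv0
    have hnz : (n : ℤ) = q ^ 2 + 1 := by exact_mod_cast hn
    suffices H : ∃ i : ℕ, ∃ x : ℤ, (x : ZMod n) = ((s : ZMod n) - h) * (q : ZMod n) ^ i ∧
        |x| ≤ h ∧ q ≤ |x| by
      obtain ⟨i, x, hx, hxh, hxq⟩ := H
      have := cosetLeader_le_half_sub hq hm hh hhq hx hxh
      omega
    -- If 1 ≤ |v| < q, then q ≤ |qv| ≤ q² - q = n - 1 - q, so the residue of qv has absolute value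
    -- at least q.
    by_cases hvq : (q : ℤ) ≤ |v|
    · exact ⟨0, v, by rw [hv]; ring, hvh, hvq⟩
    · push Not at hvq
      obtain ⟨hx, hxh⟩ := exists_intCast_abs_le_half hh (((s : ZMod n) - h) * q)
      refine ⟨1, _, by rw [hx, pow_one], hxh, ?_⟩
      set x := (((s : ZMod n) - h) * q).valMinAbs with hxdef
      by_contra! hxq
      have hab : |(q : ℤ) * v| = q * |v| := by rw [abs_mul, Nat.abs_cast]
      have h2 : (q : ℤ) * |v| ≤ q * (q - 1) := by gcongr; omega
      have h3 : (q : ℤ) ≤ q * |v| := by nlinarith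
      have hdvd : (n : ℤ) ∣ x - q * v := by
        rw [← ZMod.intCast_zmod_eq_zero_iff_dvd]
        push_cast
        rw [hx, hv]; ring
      have := Int.eq_zero_of_abs_lt_dvd hdvd (by
        refine lt_of_le_of_lt (abs_sub _ _) ?_
        rw [hab, hnz]; nlinarith)
      rw [sub_eq_zero.1 this, hab] at hxq
      omega
  have hs₂ : h + q < n := by omega
  have hs₂' : ((h + q : ℕ) : ZMod n) - h = ((q * 1 : ℤ) : ZMod n) := by push_cast; ring
  have hL₂ : cosetLeader q n (h + q) = h - q := by
    refine le_antisymm (hle _ hs₂ (by omega)) ?_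
    have := half_sub_le_cosetLeader hq hh hhq (s := h + q) (M := q * 1) (by omega) fun i => by
      rw [hs₂']
      exact exists_abs_le_mul_pow (by omega) (by omega) (by push_cast; linear_combination hm) i
    omega
  have hL₁ := cosetLeader_half hq hh hhq
  have hp₂ := hper _ hs₂ (by omega) (by omega)
  obtain ⟨s₃, hs₃, hmax⟩ := Finset.exists_max_image
    (Finset.range n \ ({0, h} ∪ (Finset.range n).filter
      fun a => cosetLeader q n a = cosetLeader q n (h + q))) (cosetLeader q n) (by
      rw [← Finset.card_pos]
      refine lt_of_lt_of_le ?_ (Finset.le_card_sdiff _ _)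
      have h1 := Finset.card_union_le {0, h} ((Finset.range n).filter
        fun a => cosetLeader q n a = cosetLeader q n (h + q))
      rw [card_cosetLeader_eq hq, hp₂] at h1
      have h2 : ({0, h} : Finset ℕ).card ≤ 2 := Finset.card_le_two
      rw [Finset.card_range]
      omega)
  simp only [Finset.mem_sdiff, Finset.mem_range, Finset.mem_union, Finset.mem_insert,
    Finset.mem_singleton, Finset.mem_filter, not_or, not_and] at hs₃ hmax
  refine ⟨h, h + q, s₃, by omega, hs₂, hs₃.1, by omega, ?_, ?_, minimalPeriod_half hhq, hp₂,
    hper _ hs₃.1 hs₃.2.1.1 hs₃.2.1.2⟩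
  · exact lt_of_le_of_ne (by rw [hL₂]; exact hle _ hs₃.1 hs₃.2.1.2) (hs₃.2.2 hs₃.1)
  · intro s hs
    by_cases h1 : s = h
    · left; rw [h1]
    by_cases h2 : cosetLeader q n s = cosetLeader q n (h + q)
    · exact Or.inr (Or.inl h2)
    right; right
    by_cases h0 : s = 0
    · rw [(cosetLeader_eq_zero_iff hq hs).2 h0]; exact Nat.zero_le _
    · exact hmax s ⟨hs, ⟨h0, h1⟩, fun _ => h2⟩

end BCH

/-! ### The second and third orbits for t ≥ 1 -/

namespace BCH

/-- An element of `ℤ/n`, `n = q ^ (4t+2) + 1`, with `t ≥ 1`, all of whose multiples by powers of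
`q` have small absolute value is `0` or lies in the orbit of `± q n / (q² + 1)`. -/
theorem exists_large_mul_pow {t q n h : ℕ} [NeZero n] (ht : 1 ≤ t) (hq3 : 3 ≤ q)
    (hn : n = q ^ (4 * t + 2) + 1) (hh : 2 * h = n) {w a : ℤ}
    (hw : ((q : ℤ) ^ 2) ^ (2 * t - 1) + 1 = ((q : ℤ) ^ 2 + 1) * w)
    (ha : a = (q : ℤ) ^ 4 * w - (q : ℤ) ^ 2 + 1)
    (hna : (n : ℤ) = ((q : ℤ) ^ 2 + 1) * a) {u : ZMod n} (hu : u ≠ 0)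
    (hm : (q : ZMod n) ^ (4 * t + 2) = -1) :
    (∃ i : ℕ, u * (q : ZMod n) ^ i = ((q * a : ℤ) : ZMod n)) ∨
    ∃ i : ℕ, ∃ v : ℤ, |v| ≤ h ∧ (v : ZMod n) = u * (q : ZMod n) ^ i ∧
      q * a + ((q : ℤ) - 1) ^ 2 * w ≤ |v| := by
  by_contra! hcon
  obtain ⟨hcon1, hcon2⟩ := hcon
  set v : ℕ → ℤ := fun i => (u * (q : ZMod n) ^ i).valMinAbs with hv
  have hv1 : ∀ i, (v i : ZMod n) = u * (q : ZMod n) ^ i := fun i => ZMod.coe_valMinAbs _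
  have hpm : ∀ i, u * (q : ZMod n) ^ (i + (4 * t + 2)) = -(u * (q : ZMod n) ^ i) := fun i => by
    rw [pow_add, hm]; ring
  have hv0 : ∀ i, v i ≠ 0 := by
    intro i hi
    have h1 := hv1 i
    rw [hi, Int.cast_zero] at h1
    apply hu
    have hqu : IsUnit (q : ZMod n) := by
      refine IsUnit.of_mul_eq_one (-(q : ZMod n) ^ (4 * t + 1)) ?_
      rw [pow_succ] at hm
      linear_combination -hm
    exact (hqu.pow i).mul_left_eq_zero.1 h1.symm
  obtain ⟨i, hi⟩ := exists_eq_of_orbit_lt ht (q := q) (w := w) (a := a) (n := n) (by omega) hw ha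
    hna (by
      rintro hdvd
      have h1 : ((q : ℤ) + 1) ∣ (q : ℤ) ^ (4 * t + 2) - 1 := by
        have h2 : ((q : ℤ) ^ 2 - 1) ∣ ((q : ℤ) ^ 2) ^ (2 * t + 1) - 1 ^ (2 * t + 1) :=
          sub_dvd_pow_sub_pow _ _ _
        rw [← pow_mul, one_pow, show 2 * (2 * t + 1) = 4 * t + 2 by ring] at h2
        exact dvd_trans ⟨(q : ℤ) - 1, by ring⟩ h2
      have h3 : ((q : ℤ) + 1) ∣ 2 := by
        have := dvd_sub hdvd h1
        rw [hn] at this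
        push_cast at this
        ring_nf at this ⊢
        exact this
      have := Int.le_of_dvd (by norm_num) h3
      omega) (x := fun i => |v i|)
    (fun i => abs_pos.2 (hv0 i))
    (fun i => by
      have : ((v (i + (4 * t + 2))).natAbs) = (v i).natAbs := by
        rw [hv]
        dsimp only
        rw [hpm, ZMod.natAbs_valMinAbs_neg]
      rw [show 2 * (2 * t + 1) = 4 * t + 2 by ring]
      simp only [Int.abs_eq_natAbs, this])
    (fun i => by
      have hd : (n : ℤ) ∣ q * v i - v (i + 1) := by
        rw [← ZMod.intCast_zmod_eq_zero_iff_dvd]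
        push_cast
        rw [hv1, hv1]
        ring
      obtain ⟨k, hk⟩ := hd
      rcases abs_choice (v i) with h1 | h1 <;> rcases abs_choice (v (i + 1)) with h2 | h2 <;>
        simp only [h1, h2]
      · exact Or.inl ⟨k, hk⟩
      · exact Or.inr ⟨k, by linarith⟩
      · exact Or.inr ⟨-k, by linarith⟩
      · exact Or.inl ⟨-k, by linarith⟩)
    (fun i => hcon2 i (v i) (exists_intCast_abs_le_half hh _).2 (hv1 i))
  -- If the value met is -qa, then qa is met 4t+2 steps later.
  rcases abs_choice (v i) with hc | hc
  · refine hcon1 i ?_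
    rw [← hv1 i, ← hi]
    simp only [hc]
  · refine hcon1 (i + (4 * t + 2)) ?_
    rw [hpm, ← hv1 i, ← hi]
    simp only [hc]
    push_cast
    ring

/-- The orbit of `b - η` stays within distance `Z` of `± b` at even times. -/
theorem exists_abs_le_mul_pow_of_even {t q n : ℕ} (ht : 1 ≤ t) (hq3 : 3 ≤ q)
    {w a : ℤ} (hw1 : 1 ≤ w)
    (hw : ((q : ℤ) ^ 2) ^ (2 * t - 1) + 1 = ((q : ℤ) ^ 2 + 1) * w)
    (ha : a = (q : ℤ) ^ 4 * w - (q : ℤ) ^ 2 + 1)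
    (hna : (((((q : ℤ) ^ 2 + 1) * a : ℤ)) : ZMod n) = 0)
    (hm : (q : ZMod n) ^ (4 * t + 2) = -1) {η : ℤ}
    (hη : η = ((q : ℤ) - 1) ^ 2 * ((q : ℤ) ^ 2 - 1)) (i : ℕ) :
    ∃ v : ℤ, |v| ≤ q * a + ((q : ℤ) - 1) ^ 2 * w ∧
      (v : ZMod n) = ((q * a - η : ℤ) : ZMod n) * (q : ZMod n) ^ i := by
  set Z := ((q : ℤ) - 1) ^ 2 * w with hZ
  have hq0 : (0 : ℤ) < q := by omega
  have hZ0 : 0 < Z := mul_pos (pow_pos (by omega) 2) (by omega)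
  have ha0 : 0 < a := by
    rw [ha]
    nlinarith [pow_pos hq0 2, mul_pos (pow_pos hq0 4) (show 0 < w by omega), pow_pos hq0 4]
  obtain ⟨s, rfl⟩ : ∃ s, t = s + 1 := ⟨t - 1, by omega⟩
  rw [show 2 * (s + 1) - 1 = 2 * s + 1 by omega] at hw
  have hη0 : 0 < η := by
    rw [hη]; exact mul_pos (pow_pos (by omega) 2) (by nlinarith)
  -- at even times
  have hnb : ((q * a : ℤ) : ZMod n) * (q : ZMod n) ^ 2 = -((q * a : ℤ) : ZMod n) := by
    push_cast at hna ⊢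
    linear_combination (q : ZMod n) * hna
  have hpow : ∀ k : ℕ, ((q * a - η : ℤ) : ZMod n) * (q : ZMod n) ^ (2 * k) =
      (-1) ^ k * ((q * a - (-(q : ℤ) ^ 2) ^ k * η : ℤ) : ZMod n) := by
    intro k
    induction k with
    | zero => simp
    | succ k ih =>
      rw [mul_add, pow_add, ← mul_assoc, ih, pow_succ, pow_succ]
      push_cast at hnb ⊢
      linear_combination (-1) ^ k * hnb
  have hPη : (q : ℤ) * a + ((q : ℤ) ^ 2) ^ (2 * s + 1) * η = ((q : ℤ) ^ 2 + 1) * a - q * a - Z := by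
    rw [show ((q : ℤ) ^ 2) ^ (2 * s + 1) = ((q : ℤ) ^ 2 + 1) * w - 1 by linarith, hη, hZ, ha]
    ring
  have hmid : ((q * a - η : ℤ) : ZMod n) * (q : ZMod n) ^ (2 * (2 * s + 1)) =
      ((q * a + Z - ((q : ℤ) ^ 2 + 1) * a : ℤ) : ZMod n) := by
    have ho : Odd (2 * s + 1) := ⟨s, rfl⟩
    rw [hpow, ho.neg_pow, ho.neg_pow, one_pow, neg_one_mul, ← Int.cast_neg]
    congr 1
    linear_combination -hPη
  have hbound : ∀ k < 2 * s + 1, -((q : ℤ) ^ 2 * Z) ≤ -((-(q : ℤ) ^ 2) ^ k * η) ∧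
      -((-(q : ℤ) ^ 2) ^ k * η) ≤ Z := by
    have hmain : ((q : ℤ) ^ 2) ^ (2 * s) * η ≤ (q : ℤ) ^ 2 * Z := by
      have h1 : ((q : ℤ) ^ 2 + 1) * (((q : ℤ) ^ 2) ^ (2 * s) * η) + ((q : ℤ) - 1) ^ 2 *
          (((q : ℤ) ^ 2) ^ (2 * s) + (q : ℤ) ^ 2) = ((q : ℤ) ^ 2 + 1) * ((q : ℤ) ^ 2 * Z) := by
        rw [hη, hZ]
        rw [pow_succ] at hw
        linear_combination ((q : ℤ) - 1) ^ 2 * (q : ℤ) ^ 2 * hw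
      have h2 : 0 ≤ ((q : ℤ) - 1) ^ 2 * (((q : ℤ) ^ 2) ^ (2 * s) + (q : ℤ) ^ 2) := by positivity
      exact le_of_mul_le_mul_left (by linarith) (show 0 < (q : ℤ) ^ 2 + 1 by positivity)
    have hmono : ∀ k ≤ 2 * s, ((q : ℤ) ^ 2) ^ k * η ≤ (q : ℤ) ^ 2 * Z := fun k hk =>
      le_trans (mul_le_mul_of_nonneg_right (pow_le_pow_right₀ (by nlinarith) hk) hη0.le) hmain
    intro k hk
    have hQ0 : 0 < (q : ℤ) ^ 2 * Z := by positivity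
    have hk0 : 0 < ((q : ℤ) ^ 2) ^ k * η := by positivity
    rcases Nat.even_or_odd k with he | ho
    · rw [he.neg_pow]
      have := hmono k (by omega)
      constructor <;> linarith
    · rw [ho.neg_pow, neg_mul, neg_neg]
      have := hmono (k + 1) (by obtain ⟨r, hr⟩ := ho; omega)
      rw [pow_succ, mul_comm _ ((q : ℤ) ^ 2), mul_assoc] at this
      exact ⟨by linarith, le_of_mul_le_mul_left this (by positivity)⟩
  -- The offsets z run through -η, q²η, …, -q^(4t-4)η, then Z, then -q²Z. After that, q^(4t+2) = -1
  -- repeats the cycle with opposite sign ε.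
  have heven : ∀ k : ℕ, ∃ z : ℤ, ∃ ε : ℤ, (ε = 1 ∨ ε = -1) ∧ -((q : ℤ) ^ 2 * Z) ≤ z ∧ z ≤ Z ∧
      ((ε * (q * a + z) : ℤ) : ZMod n) =
        ((q * a - η : ℤ) : ZMod n) * (q : ZMod n) ^ (2 * k) := by
    intro k
    induction k using Nat.strong_induction_on with
    | _ k ih =>
      rcases lt_or_ge k (2 * s + 1) with h1 | h1
      · refine ⟨-((-(q : ℤ) ^ 2) ^ k * η), (-1) ^ k, neg_one_pow_eq_or ℤ k, (hbound k h1).1,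
          (hbound k h1).2, ?_⟩
        rw [hpow]
        push_cast
        ring
      rcases eq_or_lt_of_le h1 with h1 | h1
      · refine ⟨Z, 1, Or.inl rfl, by nlinarith [pow_pos hq0 2], le_rfl, ?_⟩
        rw [← h1, hmid]
        push_cast at hna ⊢
        linear_combination hna
      rcases eq_or_lt_of_le (Nat.succ_le_iff.2 h1) with h1 | h1
      · refine ⟨-((q : ℤ) ^ 2 * Z), -1, Or.inr rfl, le_rfl, by nlinarith [pow_pos hq0 2], ?_⟩
        rw [← h1, Nat.succ_eq_add_one, mul_add 2 (2 * s + 1) 1, pow_add,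
          ← mul_assoc ((q * a - η : ℤ) : ZMod n), hmid]
        push_cast at hna ⊢
        linear_combination ((q : ZMod n) ^ 2 - q) * hna
      · obtain ⟨z, ε, hε, hz1, hz2, hz⟩ := ih (k - (2 * s + 3)) (by omega)
        refine ⟨z, -ε, by omega, hz1, hz2, ?_⟩
        obtain ⟨j, rfl⟩ : ∃ j, k = j + (2 * s + 3) := ⟨k - (2 * s + 3), by omega⟩
        rw [Nat.add_sub_cancel] at hz
        rw [mul_add 2 j, show 2 * (2 * s + 3) = 4 * (s + 1) + 2 by ring, pow_add, hm,
          ← mul_assoc, ← hz]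
        push_cast
        ring
  -- At odd times the absolute value is |a - qz|; this covers the extreme offset z = -q²Z.
  have hqZa : (q : ℤ) * ((q : ℤ) ^ 2 * Z) + a ≤ q * a + Z := by
    have h1 : (q : ℤ) * a + Z - ((q : ℤ) * ((q : ℤ) ^ 2 * Z) + a) =
        ((q : ℤ) - 1) * (((q : ℤ) ^ 3 + q - 1) * (w - 1) + ((q : ℤ) - 1) * (q : ℤ) ^ 2 + q) := by
      rw [hZ, ha]; ring
    have h2 : 0 ≤ (q : ℤ) - 1 := by omega
    have h3 : 0 ≤ w - 1 := by omega
    have h4 : 0 ≤ (q : ℤ) ^ 3 + q - 1 := by have := pow_pos hq0 3; omega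
    have h5 : 0 ≤ ((q : ℤ) - 1) * (((q : ℤ) ^ 3 + q - 1) * (w - 1) +
      ((q : ℤ) - 1) * (q : ℤ) ^ 2 + q) := by positivity
    linarith
  have hqZ2 : (q : ℤ) ^ 2 * Z ≤ 2 * (q * a) := by
    nlinarith
  have hqZ3 : (q : ℤ) * Z ≤ 2 * a := by
    nlinarith [pow_pos hq0 2]
  obtain ⟨k, hk⟩ := Nat.even_or_odd' i
  obtain ⟨z, ε, hε, hz1, hz2, hz⟩ := heven k
  have hqz1 : -((q : ℤ) * ((q : ℤ) ^ 2 * Z)) ≤ q * z := by nlinarith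
  have hqz2 : (q : ℤ) * z ≤ q * Z := by nlinarith
  rcases hk with rfl | rfl
  · refine ⟨ε * (q * a + z), ?_, hz⟩
    rw [abs_mul, show |ε| = 1 by rcases hε with rfl | rfl <;> simp, one_mul, abs_le]
    constructor <;> linarith
  · refine ⟨-ε * (a - q * z), ?_, ?_⟩
    · rw [abs_mul, show |-ε| = 1 by rcases hε with rfl | rfl <;> simp, one_mul, abs_le]
      have : 0 < (q : ℤ) * a := by positivity
      constructor <;> nlinarith
    · rw [pow_succ, ← mul_assoc, ← hz]
      push_cast at hna ⊢
      linear_combination -(ε : ZMod n) * hna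

end BCH

/-! ### Length of the third orbit, and the three largest leaders -/

namespace BCH

/-- The multiples of `b - η` by `q ^ (2 r) + 1` with `r` odd and small do not vanish. -/
theorem mul_pow_add_one_ne_zero {q n N r : ℕ} (hq3 : 3 ≤ q) (hn : n = (q ^ 2) ^ N + 1) {a η : ℤ}
    (hna : (((((q : ℤ) ^ 2 + 1) * a : ℤ)) : ZMod n) = 0)
    (hη : η = ((q : ℤ) - 1) ^ 2 * ((q : ℤ) ^ 2 - 1)) (hr : Odd r) (hrN : r + 2 ≤ N) :
    ((q * a - η : ℤ) : ZMod n) * (((q : ZMod n) ^ 2) ^ r + 1) ≠ 0 := by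
  intro h0
  -- As r is odd, q^(2r) + 1 is a multiple of q² + 1 and kills a modulo n. So n would divide
  -- η(q^(2r) + 1), which is positive and smaller than n.
  obtain ⟨d, hd⟩ : (q : ℤ) ^ 2 + 1 ∣ ((q : ℤ) ^ 2) ^ r + 1 := by
    simpa using hr.add_dvd_pow_add_pow ((q : ℤ) ^ 2) 1
  have hdvd : (n : ℤ) ∣ η * (((q : ℤ) ^ 2) ^ r + 1) := by
    rw [← ZMod.intCast_zmod_eq_zero_iff_dvd]
    have hd' : ((q : ZMod n) ^ 2) ^ r + 1 = ((q : ZMod n) ^ 2 + 1) * (d : ZMod n) := by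
      have := congrArg (Int.cast : ℤ → ZMod n) hd
      push_cast at this
      exact this
    push_cast at h0 hna ⊢
    rw [hd'] at h0 ⊢
    linear_combination (q : ZMod n) * d * hna - h0
  have hη0 : 0 < η := by rw [hη]; exact mul_pos (pow_pos (by omega) 2) (by nlinarith)
  have hle := Int.le_of_dvd (mul_pos hη0 (by positivity)) hdvd
  have h1 : ((q : ℤ) ^ 2) ^ (r + 2) ≤ ((q : ℤ) ^ 2) ^ N := pow_le_pow_right₀ (by nlinarith) hrN
  have h2 : η ≤ ((q : ℤ) ^ 2 - 1) ^ 2 := by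
    rw [hη, pow_two ((q : ℤ) ^ 2 - 1)]
    gcongr
    · nlinarith
    · nlinarith
  have h3 : (q : ℤ) ^ 2 ≤ ((q : ℤ) ^ 2) ^ r := by
    obtain ⟨j, rfl⟩ := hr
    calc (q : ℤ) ^ 2 = ((q : ℤ) ^ 2) ^ 1 := (pow_one _).symm
      _ ≤ _ := pow_le_pow_right₀ (by nlinarith) (by omega)
  have hnz : (n : ℤ) = ((q : ℤ) ^ 2) ^ N + 1 := by exact_mod_cast hn
  rw [pow_add] at h1
  have h4 : (9 : ℤ) ≤ (q : ℤ) ^ 2 := by nlinarith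
  set Q := (q : ℤ) ^ 2
  set R := Q ^ r
  have h5 : η * (R + 1) ≤ (Q - 1) ^ 2 * (R + 1) :=
    mul_le_mul_of_nonneg_right h2 (by positivity)
  nlinarith [mul_nonneg (show 0 ≤ R - Q by omega) (show 0 ≤ Q by omega)]

/-- The period divides 4N but not 2N, so it is 4r with N = er and e odd. If e = 2f + 1 > 1, then
q^(2N) = q^(4rf) q^(2r) acts on s - h as q^(2r), so q^(2r) + 1 annihilates s - h, against `hs`. -/
theorem minimalPeriod_eq_four_mul {q n h N : ℕ} [NeZero n] (hh : 2 * h = n)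
    (hhq : (h : ZMod n) * q = h) (hN : Odd N) (hm : (q : ZMod n) ^ (2 * N) = -1) {s : ZMod n}
    (h0 : s ≠ 0) (h1 : s ≠ h)
    (hs : ∀ r, Odd r → r + 2 ≤ N → (s - h) * (((q : ZMod n) ^ 2) ^ r + 1) ≠ 0) :
    Function.minimalPeriod (fun x : ZMod n => x * q) s = 4 * N := by
  set k := Function.minimalPeriod (fun x : ZMod n => x * q) s with hk
  have hk1 : k ∣ 4 * N := by
    refine Function.IsPeriodicPt.minimalPeriod_dvd ?_
    rw [isPeriodicPt_mul_right_iff hhq, show 4 * N = 2 * N + 2 * N by ring, pow_add, hm]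
    ring
  have hk2 : ¬ k ∣ 2 * N := by
    intro hc
    have := (isPeriodicPt_mul_right_iff hhq s (2 * N)).1
      ((Function.isPeriodicPt_iff_minimalPeriod_dvd).2 hc)
    rw [hm] at this
    rcases eq_zero_or_half_of_two_mul hh (x := s - h) (by linear_combination -this) with h' | h'
    · exact h1 (sub_eq_zero.1 h')
    · exact h0 (by linear_combination h' + two_mul_half hh)
  obtain ⟨e, he⟩ := hk1
  have heo : Odd e := by
    rw [← Nat.not_even_iff_odd]
    rintro ⟨f, rfl⟩
    exact hk2 ⟨f, by linarith⟩
  have heN : e ∣ N := by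
    have hco : Nat.Coprime e 4 := by
      rw [show 4 = 2 ^ 2 by norm_num]
      exact Nat.Coprime.pow_right 2 heo.coprime_two_right
    exact hco.dvd_of_dvd_mul_left ⟨k, by rw [he]; ring⟩
  obtain ⟨r, hr⟩ := heN
  have hk4 : k = 4 * r := by
    have : e * k = e * (4 * r) := by rw [mul_comm e k, ← he, hr]; ring
    exact Nat.eq_of_mul_eq_mul_left heo.pos this
  have hro : Odd r := by
    rw [hr] at hN
    exact (Nat.odd_mul.1 hN).2
  obtain ⟨f, hf⟩ := heo
  rcases Nat.eq_zero_or_pos f with rfl | hfpos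
  · rw [hk4, hr, hf]; ring
  exfalso
  refine hs r hro (by rw [hr, hf]; nlinarith [hro.pos]) ?_
  have hper : (s - h) * (q : ZMod n) ^ (k * f) = s - h :=
    (isPeriodicPt_mul_right_iff hhq s (k * f)).1 ((Function.isPeriodicPt_minimalPeriod _ _).mul_const f)
  have hNe : 2 * N = k * f + 2 * r := by rw [hr, hk4, hf]; ring
  rw [hNe, pow_add, pow_mul _ 2 r] at hm
  linear_combination (s - h) * hm - ((q : ZMod n) ^ 2) ^ r * hper

theorem topCosets_of_pos {t q n : ℕ} (ht : 1 ≤ t) (hq3 : 3 ≤ q) (hodd : Odd q)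
    (hn : n = q ^ (4 * t + 2) + 1) : TopCosets q n (4 * t + 2) := by
  have : NeZero n := ⟨by omega⟩
  obtain ⟨h, hh⟩ : ∃ h, 2 * h = n := by
    obtain ⟨k, hk⟩ := (hodd.pow (n := 4 * t + 2)).add_odd odd_one
    exact ⟨k, by rw [hn, hk]; ring⟩
  have hm : (q : ZMod n) ^ (4 * t + 2) = -1 := by
    have : ((q ^ (4 * t + 2) + 1 : ℕ) : ZMod n) = 0 := by rw [← hn]; simp
    push_cast at this
    linear_combination this
  have hq : IsUnit (q : ZMod n) := by
    refine IsUnit.of_mul_eq_one (-(q : ZMod n) ^ (4 * t + 1)) ?_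
    rw [pow_succ] at hm
    linear_combination -hm
  have hhq : (h : ZMod n) * q = h := by
    obtain ⟨r, hr⟩ := hodd
    rw [hr]; push_cast
    linear_combination (r : ZMod n) * two_mul_half hh
  obtain ⟨w, hw⟩ : (q : ℤ) ^ 2 + 1 ∣ ((q : ℤ) ^ 2) ^ (2 * t - 1) + 1 := by
    have : Odd (2 * t - 1) := ⟨t - 1, by omega⟩
    simpa using this.add_dvd_pow_add_pow ((q : ℤ) ^ 2) 1
  have hw1 : 1 ≤ w := by
    have : 0 < ((q : ℤ) ^ 2) ^ (2 * t - 1) + 1 := by positivity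
    rw [hw] at this
    exact pos_of_mul_pos_right this (by positivity)
  obtain ⟨a, ha⟩ : ∃ a, a = (q : ℤ) ^ 4 * w - (q : ℤ) ^ 2 + 1 := ⟨_, rfl⟩
  have hna : (n : ℤ) = ((q : ℤ) ^ 2 + 1) * a := by
    have h1 : q ^ (4 * t + 2) = q ^ 4 * (q ^ 2) ^ (2 * t - 1) := by
      rw [← pow_mul, ← pow_add]; congr 1; omega
    rw [hn, h1, ha]
    push_cast
    linear_combination (q : ℤ) ^ 4 * hw
  have hna0 : (((((q : ℤ) ^ 2 + 1) * a : ℤ)) : ZMod n) = 0 := by rw [← hna]; simp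
  obtain ⟨η, hη⟩ : ∃ η, η = ((q : ℤ) - 1) ^ 2 * ((q : ℤ) ^ 2 - 1) := ⟨_, rfl⟩
  obtain ⟨Z, hZ⟩ : ∃ Z, Z = ((q : ℤ) - 1) ^ 2 * w := ⟨_, rfl⟩
  have hhz : 2 * (h : ℤ) = ((q : ℤ) ^ 2 + 1) * a := by rw [← hna]; exact_mod_cast hh
  have hq3' : (3 : ℤ) ≤ q := by exact_mod_cast hq3
  have hq2 : 3 * (q : ℤ) ≤ (q : ℤ) ^ 2 := by nlinarith
  have hZ0 : 0 < Z := by rw [hZ]; exact mul_pos (pow_pos (by omega) 2) (by omega)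
  have haw : 2 * w < a := by
    have h1 : (9 : ℤ) ≤ (q : ℤ) ^ 2 := by nlinarith
    have h2 : 9 * (q : ℤ) ^ 2 ≤ (q : ℤ) ^ 4 := by nlinarith
    rw [ha]; nlinarith
  have ha0 : 0 < a := by omega
  have hMh : q * a + Z < h := by
    have h1 : ((q : ℤ) - 1) ^ 2 * (2 * w) < ((q : ℤ) - 1) ^ 2 * a :=
      mul_lt_mul_of_pos_left haw (pow_pos (by omega) 2)
    rw [hZ]; nlinarith
  have hη0 : 0 < η := by rw [hη]; exact mul_pos (pow_pos (by omega) 2) (by nlinarith)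
  have hηb : η < q * a := by
    have h1 : η ≤ (q : ℤ) ^ 2 * (q : ℤ) ^ 2 := by
      rw [hη]; gcongr <;> nlinarith
    have h2 : (9 : ℤ) ≤ (q : ℤ) ^ 2 := by nlinarith
    have h3 : (q : ℤ) ^ 4 - (q : ℤ) ^ 2 + 1 ≤ a := by
      rw [ha]; nlinarith [pow_pos (show (0 : ℤ) < q by omega) 4]
    nlinarith
  have hlt_of : ∀ x : ℤ, x ≠ 0 → |x| < h → (x : ZMod n) ≠ 0 ∧ (x : ZMod n) ≠ h ∧
      (x : ZMod n) ≠ -h := by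
    intro x hx0 hxh
    have hnh : (n : ℤ) = 2 * h := by exact_mod_cast hh.symm
    rw [abs_lt] at hxh
    have h0 : (x : ZMod n) ≠ 0 := by
      rw [Ne, ZMod.intCast_zmod_eq_zero_iff_dvd]
      intro hc
      exact hx0 (Int.eq_zero_of_abs_lt_dvd hc (by rw [abs_lt]; omega))
    have h1 : (x : ZMod n) ≠ h := by
      intro hc
      have : ((x - h : ℤ) : ZMod n) = 0 := by push_cast; rw [hc]; ring
      rw [ZMod.intCast_zmod_eq_zero_iff_dvd] at this
      have := Int.eq_zero_of_abs_lt_dvd this (by rw [abs_lt]; omega)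
      omega
    exact ⟨h0, h1, fun hc => h1 (by rw [hc]; linear_combination -two_mul_half hh)⟩
  have hrep : ∀ x : ℤ, ((((h : ℤ) + x : ℤ) : ZMod n).val : ZMod n) = h + x := fun x => by
    rw [ZMod.natCast_zmod_val]; push_cast; ring
  have habs : |(q : ℤ) * a| = q * a := abs_of_nonneg (by positivity)
  -- the second coset
  obtain ⟨s₂, hs₂, hs₂'⟩ : ∃ s₂ < n, (s₂ : ZMod n) - h = ((q * a : ℤ) : ZMod n) :=
    ⟨_, ZMod.val_lt _, by rw [hrep]; ring⟩
  obtain ⟨s₃, hs₃, hs₃'⟩ : ∃ s₃ < n, (s₃ : ZMod n) - h = ((q * a - η : ℤ) : ZMod n) :=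
    ⟨_, ZMod.val_lt _, by rw [hrep]; ring⟩
  have hL₁ := cosetLeader_half hq hh hhq
  have hL₂ : (cosetLeader q n s₂ : ℤ) = h - q * a := by
    refine le_antisymm ?_ ?_
    · rw [← habs]
      exact cosetLeader_le_half_sub (i := 0) hq hm hh hhq (by rw [hs₂']; simp)
        (by rw [habs]; omega)
    · refine half_sub_le_cosetLeader hq hh hhq (by omega) fun i => ?_
      rw [hs₂']
      exact exists_abs_le_mul_pow (by omega) ha0.le hna0 i
  have hL₃ : h - (q * a + Z) ≤ (cosetLeader q n s₃ : ℤ) := by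
    refine half_sub_le_cosetLeader hq hh hhq hMh fun i => ?_
    rw [hs₃', hZ]
    exact exists_abs_le_mul_pow_of_even ht hq3 hw1 hw ha hna0 hm hη i
  have hmax : ∀ s < n, s ≠ h → cosetLeader q n s = cosetLeader q n s₂ ∨
      (cosetLeader q n s : ℤ) ≤ h - (q * a + Z) := by
    intro s hs hsh
    have hu : (s : ZMod n) - h ≠ 0 := by
      intro hc
      have := congrArg ZMod.val (sub_eq_zero.1 hc)
      rw [ZMod.val_cast_of_lt hs, ZMod.val_cast_of_lt (by omega)] at this
      exact hsh this
    rcases exists_large_mul_pow ht hq3 hn hh hw ha hna hu hm with ⟨i, hi⟩ | ⟨i, v, hv, hvi, hvM⟩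
    · left
      refine ((cosetLeader_eq_iff hq).2 ⟨i, ?_⟩).symm
      rw [← hs₂'] at hi
      linear_combination -hi - half_mul_pow hhq i
    · right
      have := cosetLeader_le_half_sub hq hm hh hhq hvi hv
      rw [hZ]; omega
  have hNn : n = (q ^ 2) ^ (2 * t + 1) + 1 := by rw [hn, ← pow_mul]; congr 2; ring
  have hs₃r : ∀ r, Odd r → r + 2 ≤ 2 * t + 1 →
      ((s₃ : ZMod n) - h) * (((q : ZMod n) ^ 2) ^ r + 1) ≠ 0 := by
    intro r hr hrN
    rw [hs₃']
    exact mul_pow_add_one_ne_zero hq3 hNn hna0 hη hr hrN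
  -- Every element of the second orbit is annihilated by q² + 1, while qa - η is not: this is the
  -- case r = 1 of `hs₃r`.
  have hL₃₂ : cosetLeader q n s₃ ≠ cosetLeader q n s₂ := by
    intro hc
    obtain ⟨i, hi⟩ := (cosetLeader_eq_iff hq).1 hc
    refine hs₃r 1 odd_one (by omega) ?_
    have h1 : (s₃ : ZMod n) - h = ((q * a : ℤ) : ZMod n) * (q : ZMod n) ^ i := by
      rw [hi, ← hs₂']; linear_combination half_mul_pow hhq i
    rw [h1]
    push_cast at hna0 ⊢
    linear_combination (q : ZMod n) * (q : ZMod n) ^ i * hna0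
  have hne : ∀ s : ℕ, ∀ x : ℤ, (s : ZMod n) - h = (x : ZMod n) → x ≠ 0 → |x| < h →
      (s : ZMod n) ≠ 0 ∧ (s : ZMod n) ≠ h := by
    intro s x hx hx0 hxh
    obtain ⟨h1, h2, h3⟩ := hlt_of x hx0 hxh
    exact ⟨fun hc => h3 (by rw [← hx, hc]; ring), fun hc => h1 (by rw [← hx, hc]; ring)⟩
  obtain ⟨h20, h21⟩ := hne s₂ _ hs₂' (by positivity) (by rw [habs]; omega)
  obtain ⟨h30, h31⟩ := hne s₃ _ hs₃' (by omega) (by rw [abs_lt]; constructor <;> linarith)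
  have hs₃h : s₃ ≠ h := fun hc => h31 (by rw [hc])
  refine ⟨h, s₂, s₃, by have := NeZero.pos n; omega, hs₂, hs₃, ?_, ?_, ?_, minimalPeriod_half hhq,
    minimalPeriod_eq_four hh hhq ?_ h20 h21, ?_⟩
  · have : 0 < (q : ℤ) * a := by positivity
    omega
  · rcases hmax s₃ hs₃ hs₃h with h' | h'
    · exact absurd h' hL₃₂
    · omega
  · intro s hs
    by_cases hsh : s = h
    · left; rw [hsh]
    · rcases hmax s hs hsh with h' | h'
      · exact Or.inr (Or.inl h')
      · right; right; omega
  · rw [hs₂']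
    push_cast at hna0 ⊢
    linear_combination (q : ZMod n) * hna0
  · rw [minimalPeriod_eq_four_mul hh hhq (N := 2 * t + 1) ⟨t, rfl⟩
      (by rw [← hm]; congr 1; ring) h30 h31 hs₃r]
    ring

theorem topCosets {t q n m : ℕ} (hq3 : 3 ≤ q) (hodd : Odd q) (hm : m = 4 * t + 2)
    (hn : n = q ^ m + 1) : TopCosets q n m := by
  subst hm
  rcases Nat.eq_zero_or_pos t with rfl | ht
  · exact topCosets_two hq3 hodd hn
  · exact topCosets_of_pos ht hq3 hodd hn

end BCH

/-! ### Cyclic codes: zeros, dimension, BCH bound, duality -/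

namespace BCH

open Polynomial

section Conjugates

variable {F E : Type*} [Field F] [Finite F] [Field E] [Algebra F E]

/-- Over a finite field with `q` elements, the conjugates of `y` are the powers `y ^ (q ^ i)`. -/
theorem aeval_minpoly_eq_zero_iff {q : ℕ} (hF : Nat.card F = q) {y z : E} (hy : IsIntegral F y) :
    aeval z (minpoly F y) = 0 ↔ ∃ i : ℕ, z = y ^ q ^ i := by
  have : Fintype F := Fintype.ofFinite F
  rw [Nat.card_eq_fintype_card] at hF
  subst hF
  constructor
  · intro hz
    let K := IntermediateField.adjoin F {y}
    have : FiniteDimensional F K := IntermediateField.adjoin.finiteDimensional hy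
    have : Finite K := Module.finite_of_finite F
    let y' : K := IntermediateField.AdjoinSimple.gen F y
    have hy' : algebraMap K E y' = y := IntermediateField.AdjoinSimple.algebraMap_gen F y
    have hmin : minpoly F y' = minpoly F y := by
      rw [← hy', minpoly.algebraMap_eq (algebraMap K E).injective]
    have hs : ((minpoly F y').map (algebraMap F K)).Splits := Normal.splits inferInstance y'
    obtain ⟨z', hz'⟩ : z ∈ (algebraMap K E).range := by
      refine hs.mem_range_of_isRoot (f := (minpoly F y').map (algebraMap F K))
        (Polynomial.map_ne_zero (minpoly.ne_zero (IsIntegral.of_finite F y'))) ?_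
      rw [Polynomial.map_map, ← IsScalarTower.algebraMap_eq, hmin, IsRoot.def, eval_map_algebraMap, hz]
    have hz0 : aeval z' (minpoly F y') = 0 := by
      apply (algebraMap K E).injective
      rw [← aeval_algebraMap_apply, hz', hmin, hz, map_zero]
    have hconj : IsConjRoot F z' y' := by
      have hint : IsIntegral F y' := IsIntegral.of_finite F y'
      rw [isConjRoot_def]
      exact (minpoly.eq_of_irreducible_of_monic (minpoly.irreducible hint) hz0
        (minpoly.monic hint)).symm
    obtain ⟨σ, hσ⟩ := isConjRoot_iff_exists_algEquiv.1 hconj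
    obtain ⟨i, rfl⟩ := (FiniteField.bijective_frobeniusAlgEquivOfAlgebraic_pow F K).2 σ
    refine ⟨i, ?_⟩
    rw [← hz', ← hσ, ← hy', ← map_pow]
    congr 1
    dsimp only
    rw [AlgEquiv.coe_pow, FiniteField.coe_frobeniusAlgEquivOfAlgebraic_iterate]
  · rintro ⟨i, rfl⟩
    have h := FiniteField.coe_frobeniusAlgHom F E
    have : y ^ Fintype.card F ^ i = (FiniteField.frobeniusAlgHom F E ^ i) y := by
      rw [AlgHom.coe_pow, h, pow_iterate]
    rw [this, aeval_algHom_apply, minpoly.aeval, map_zero]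

end Conjugates

section Cyclic

variable {F E : Type*} [Field F] [Field E] [Algebra F E] {n : ℕ} {β : E} {g : F[X]}

/-- The polynomial with the given vector of coefficients. -/
noncomputable def vecPoly (F : Type*) [Field F] (n : ℕ) : (Fin n → F) →ₗ[F] F[X] :=
  Fintype.linearCombination F fun i : Fin n => X ^ (i : ℕ)

theorem aeval_vecPoly (c : Fin n → F) (x : E) :
    aeval x (vecPoly F n c) = ∑ i, algebraMap F E (c i) * x ^ (i : ℕ) := by
  simp [vecPoly, Fintype.linearCombination_apply, Algebra.smul_def]

theorem vecToQuot_eq (c : Fin n → F) :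
    vecToQuot F n c = AdjoinRoot.mk (X ^ n - 1 : F[X]) (vecPoly F n c) := by
  simp only [vecToQuot, vecPoly, Fintype.linearCombination_apply, map_sum]
  refine Finset.sum_congr rfl fun i _ => ?_
  rw [smul_eq_C_mul, map_mul, map_pow, AdjoinRoot.mk_X, AdjoinRoot.mk_C, Algebra.smul_def,
    AdjoinRoot.algebraMap_eq]

theorem exists_vecPoly_eq {p : F[X]} (hp : p.degree < n) : ∃ c, vecPoly F n c = p := by
  refine ⟨fun i => p.coeff i, ?_⟩
  rw [vecPoly, Fintype.linearCombination_apply,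
    Fin.sum_univ_eq_sum_range (fun i => p.coeff i • (X ^ i : F[X])) n]
  rcases eq_or_ne p 0 with rfl | h0
  · simp
  · conv_rhs => rw [p.as_sum_range_C_mul_X_pow' ((natDegree_lt_iff_degree_lt h0).2 hp)]
    simp only [smul_eq_C_mul]

theorem mem_cyclicCode_iff_dvd (hg : g ∣ X ^ n - 1) (c : Fin n → F) :
    c ∈ cyclicCode n g ↔ g ∣ vecPoly F n c := by
  rw [cyclicCode, Submodule.mem_comap, Submodule.restrictScalars_mem, Ideal.mem_span_singleton,
    vecToQuot_eq]
  constructor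
  · rintro ⟨x, hx⟩
    obtain ⟨p, rfl⟩ := AdjoinRoot.mk_surjective x
    rw [← map_mul, AdjoinRoot.mk_eq_mk] at hx
    exact (dvd_sub_left (Dvd.intro p rfl)).1 (hg.trans hx)
  · rintro ⟨p, hp⟩
    exact ⟨AdjoinRoot.mk _ p, by rw [hp, map_mul]⟩

/-- The code is the kernel of c ↦ c(x) mod g, which maps onto F[x]/(g) because deg g ≤ n. -/
theorem finrank_cyclicCode [NeZero n] (hg : g ∣ X ^ n - 1) :
    Module.finrank F (cyclicCode n g) + g.natDegree = n := by
  have hf0 : (X ^ n - 1 : F[X]) ≠ 0 := (monic_X_pow_sub_C (1 : F) (NeZero.ne n)).ne_zero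
  have hg0 : g ≠ 0 := ne_zero_of_dvd_ne_zero hf0 hg
  have hdeg : g.natDegree ≤ n := by
    have := natDegree_le_of_dvd hg hf0
    rwa [← C_1, natDegree_X_pow_sub_C] at this
  let φ : (Fin n → F) →ₗ[F] (F[X] ⧸ Ideal.span {g}) :=
    (Ideal.Quotient.mkₐ F (Ideal.span {g})).toLinearMap ∘ₗ vecPoly F n
  have hker : LinearMap.ker φ = cyclicCode n g := by
    ext c
    rw [mem_cyclicCode_iff_dvd hg, LinearMap.mem_ker]
    change Ideal.Quotient.mk (Ideal.span {g}) (vecPoly F n c) = 0 ↔ _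
    rw [Ideal.Quotient.eq_zero_iff_mem, Ideal.mem_span_singleton]
  have hsurj : Function.Surjective φ := by
    intro x
    obtain ⟨p, rfl⟩ := Ideal.Quotient.mk_surjective x
    have h1 : (p % g).degree < n :=
      lt_of_lt_of_le (EuclideanDomain.mod_lt p hg0) (degree_le_of_natDegree_le hdeg)
    obtain ⟨c, hc⟩ := exists_vecPoly_eq h1
    refine ⟨c, ?_⟩
    change Ideal.Quotient.mk (Ideal.span {g}) (vecPoly F n c) = _
    rw [hc, Ideal.Quotient.eq, Ideal.mem_span_singleton]
    exact ⟨-(p / g), by linear_combination EuclideanDomain.mod_add_div p g⟩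
  have := LinearMap.finrank_range_add_finrank_ker φ
  rw [LinearMap.range_eq_top.2 hsurj, finrank_top, finrank_quotient_span_eq_natDegree, hker,
    Module.finrank_fin_fun] at this
  omega

theorem splits_map_and_nodup_roots (hβ : IsPrimitiveRoot β n) [NeZero n] (hg : g ∣ X ^ n - 1) :
    (g.map (algebraMap F E)).Splits ∧ (g.map (algebraMap F E)).roots.Nodup := by
  have hf0 : (X ^ n - C 1 : E[X]) ≠ 0 := (monic_X_pow_sub_C (1 : E) (NeZero.ne n)).ne_zero
  have hdvd : g.map (algebraMap F E) ∣ X ^ n - C 1 := by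
    have := Polynomial.map_dvd (algebraMap F E) hg
    simpa using this
  exact ⟨(X_pow_sub_one_splits hβ).of_dvd hf0 hdvd,
    Multiset.nodup_of_le (roots.le_of_dvd hf0 hdvd) hβ.nthRoots_one_nodup⟩

/-- Since x^n - 1 has n distinct roots in E, its divisor g splits there with simple roots, all
powers of β. -/
theorem dvd_iff_forall_aeval (hβ : IsPrimitiveRoot β n) [NeZero n] (hg : g ∣ X ^ n - 1) {p : F[X]} :
    g ∣ p ↔ ∀ s < n, aeval (β ^ s) g = 0 → aeval (β ^ s) p = 0 := by
  constructor
  · rintro ⟨r, rfl⟩ s - hs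
    rw [map_mul, hs, zero_mul]
  · intro h
    rcases eq_or_ne p 0 with rfl | hp
    · exact dvd_zero g
    obtain ⟨hs, hnd⟩ := splits_map_and_nodup_roots hβ hg
    have hf0 : (X ^ n - 1 : F[X]) ≠ 0 := (monic_X_pow_sub_C (1 : F) (NeZero.ne n)).ne_zero
    have hg0 : g ≠ 0 := ne_zero_of_dvd_ne_zero hf0 hg
    rw [← Polynomial.map_dvd_map' (algebraMap F E)]
    rw [hs.dvd_iff_roots_le_roots (Polynomial.map_ne_zero hg0) (Polynomial.map_ne_zero hp)]
    rw [Multiset.le_iff_subset hnd]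
    intro x hx
    rw [mem_roots (Polynomial.map_ne_zero hg0), IsRoot.def, eval_map_algebraMap] at hx
    rw [mem_roots (Polynomial.map_ne_zero hp), IsRoot.def, eval_map_algebraMap]
    have hx1 : x ^ n = 1 := by
      obtain ⟨r, hr⟩ := hg
      have := congrArg (aeval x) hr
      rw [map_mul, hx, zero_mul] at this
      simpa [sub_eq_zero] using this
    obtain ⟨s, hs, rfl⟩ := hβ.eq_pow_of_pow_eq_one hx1
    exact h s hs hx

theorem natDegree_eq_card (hβ : IsPrimitiveRoot β n) [NeZero n] [DecidableEq E]
    (hg : g ∣ X ^ n - 1) :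
    g.natDegree = ((Finset.range n).filter fun s => aeval (β ^ s) g = 0).card := by
  obtain ⟨hs, hnd⟩ := splits_map_and_nodup_roots hβ hg
  have hf0 : (X ^ n - 1 : F[X]) ≠ 0 := (monic_X_pow_sub_C (1 : F) (NeZero.ne n)).ne_zero
  have hg0 : g ≠ 0 := ne_zero_of_dvd_ne_zero hf0 hg
  rw [← natDegree_map (algebraMap F E), hs.natDegree_eq_card_roots,
    ← Multiset.toFinset_card_of_nodup hnd]
  symm
  refine Finset.card_bij (fun s _ => β ^ s) ?_ ?_ ?_
  · intro s hs
    rw [Multiset.mem_toFinset, mem_roots (Polynomial.map_ne_zero hg0), IsRoot.def,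
      eval_map_algebraMap]
    exact (Finset.mem_filter.1 hs).2
  · intro s hs s' hs' h
    exact hβ.pow_inj (Finset.mem_range.1 (Finset.mem_filter.1 hs).1)
      (Finset.mem_range.1 (Finset.mem_filter.1 hs').1) h
  · intro x hx
    rw [Multiset.mem_toFinset, mem_roots (Polynomial.map_ne_zero hg0), IsRoot.def,
      eval_map_algebraMap] at hx
    have hx1 : x ^ n = 1 := by
      obtain ⟨r, hr⟩ := hg
      have := congrArg (aeval x) hr
      rw [map_mul, hx, zero_mul] at this
      simpa [sub_eq_zero] using this
    obtain ⟨s, hs, rfl⟩ := hβ.eq_pow_of_pow_eq_one hx1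
    exact ⟨s, Finset.mem_filter.2 ⟨Finset.mem_range.2 hs, hx⟩, rfl⟩

theorem mem_cyclicCode_iff (hβ : IsPrimitiveRoot β n) [NeZero n] (hg : g ∣ X ^ n - 1)
    (c : Fin n → F) :
    c ∈ cyclicCode n g ↔ ∀ s < n, aeval (β ^ s) g = 0 → aeval (β ^ s) (vecPoly F n c) = 0 := by
  rw [mem_cyclicCode_iff_dvd hg, dvd_iff_forall_aeval hβ hg]

/-- The BCH bound. -/
theorem lt_hammingNorm [DecidableEq F] (hβ : IsPrimitiveRoot β n) {c : Fin n → F} (hc : c ≠ 0)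
    {w b : ℕ} (h : ∀ j < w, aeval (β ^ (b + j)) (vecPoly F n c) = 0) : w < hammingNorm c := by
  classical
  by_contra! hcon
  obtain ⟨i₀, hi₀⟩ := Function.ne_iff.1 hc
  set S := Finset.univ.filter fun i => c i ≠ 0 with hS
  have hmem : i₀ ∈ S := by simpa [hS] using hi₀
  -- P has degree below w and vanishes at every support point but one. Combining the w vanishing
  -- evaluations with its coefficients isolates the single term at i₀, which is nonzero.
  let P : E[X] := ∏ i ∈ S.erase i₀, (X - C (β ^ (i : ℕ)))
  have hdeg : P.natDegree < w := by
    rw [natDegree_prod_of_monic _ _ fun i _ => monic_X_sub_C _]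
    simp only [natDegree_X_sub_C, Finset.sum_const, smul_eq_mul, mul_one]
    exact lt_of_lt_of_le (Finset.card_erase_lt_of_mem hmem) hcon
  have hsum : ∑ i, algebraMap F E (c i) * (β ^ (i : ℕ)) ^ b * P.eval (β ^ (i : ℕ)) = 0 := by
    simp only [eval_eq_sum_range' hdeg, Finset.mul_sum]
    rw [Finset.sum_comm]
    refine Finset.sum_eq_zero fun j hj => ?_
    have := h j (Finset.mem_range.1 hj)
    rw [aeval_vecPoly] at this
    calc _ = P.coeff j * ∑ i, algebraMap F E (c i) * (β ^ (b + j)) ^ (i : ℕ) := by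
          rw [Finset.mul_sum]
          refine Finset.sum_congr rfl fun i _ => ?_
          ring
      _ = 0 := by rw [this, mul_zero]
  rw [Finset.sum_eq_single i₀] at hsum
  · have hn : n ≠ 0 := by rintro rfl; exact i₀.elim0
    have hβ0 : β ≠ 0 := hβ.ne_zero hn
    have hP : P.eval (β ^ (i₀ : ℕ)) ≠ 0 := by
      rw [eval_prod, Finset.prod_ne_zero_iff]
      intro i hi
      rw [eval_sub, eval_X, eval_C, sub_ne_zero]
      intro heq
      exact (Finset.mem_erase.1 hi).1 (Fin.ext (hβ.pow_inj i₀.2 i.2 heq)).symm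
    have hc0 : algebraMap F E (c i₀) ≠ 0 := by
      rw [Ne, map_eq_zero]; exact hi₀
    exact mul_ne_zero (mul_ne_zero hc0 (pow_ne_zero _ (pow_ne_zero _ hβ0))) hP hsum
  · intro i _ hi
    by_cases hci : c i = 0
    · rw [hci, map_zero, zero_mul, zero_mul]
    · have : P.eval (β ^ (i : ℕ)) = 0 := by
        rw [eval_prod]
        exact Finset.prod_eq_zero (Finset.mem_erase.2 ⟨hi, by simpa [hS] using hci⟩) (by simp)
      rw [this, mul_zero]
  · intro h'; exact absurd (Finset.mem_univ _) h'

theorem eq_zero_of_aeval_vecPoly (hβ : IsPrimitiveRoot β n) {c : Fin n → F}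
    (h : ∀ s < n, aeval (β ^ s) (vecPoly F n c) = 0) : c = 0 := by
  classical
  by_contra hc
  have h1 := lt_hammingNorm hβ hc (w := n) (b := 0) (by simpa using h)
  have h2 := hammingNorm_le_card_fintype (x := c)
  rw [Fintype.card_fin] at h2
  omega

theorem pow_val_add [NeZero n] {x : E} (hx : x ^ n = 1) (i k : Fin n) :
    x ^ ((i + k : Fin n) : ℕ) = x ^ (i : ℕ) * x ^ (k : ℕ) := by
  rw [Fin.val_add, ← pow_add, ← pow_eq_pow_mod _ hx]

theorem aeval_vecPoly_shift [NeZero n] {x : E} (hx : x ^ n = 1) (c : Fin n → F) (k : Fin n) :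
    aeval x (vecPoly F n fun i => c (i - k)) = x ^ (k : ℕ) * aeval x (vecPoly F n c) := by
  rw [aeval_vecPoly, aeval_vecPoly, Finset.mul_sum, ← Equiv.sum_comp (Equiv.addRight k)]
  refine Finset.sum_congr rfl fun i _ => ?_
  rw [Equiv.coe_addRight, add_sub_cancel_right, pow_val_add hx]
  ring

/-- A cyclic code whose set of zeros is closed under inversion is an LCD code. -/
theorem isLCD_cyclicCode (hβ : IsPrimitiveRoot β n) [NeZero n] (hg : g ∣ X ^ n - 1)
    (hinv : ∀ x : E, x ^ n = 1 → aeval x⁻¹ g = 0 → aeval x g = 0) : IsLCD (cyclicCode n g) := by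
  rw [IsLCD, Submodule.eq_bot_iff]
  rintro c ⟨hc, hcd⟩
  refine eq_zero_of_aeval_vecPoly hβ fun s hs => ?_
  by_cases hgs : aeval (β ^ s) g = 0
  · exact (mem_cyclicCode_iff hβ hg c).1 hc s hs hgs
  have hy : (β ^ s) ^ n = 1 := by rw [← pow_mul, mul_comm, pow_mul, hβ.pow_eq_one, one_pow]
  set y := β ^ s with hydef
  have hyi : y⁻¹ ^ n = 1 := by rw [inv_pow, hy, inv_one]
  have hgi : aeval y⁻¹ g ≠ 0 := fun h => hgs (hinv y hy h)
  -- Reduction is needed because g may have degree n.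
  obtain ⟨γ, hγ⟩ : ∃ γ : Fin n → F, vecPoly F n γ = g %ₘ (X ^ n - 1) := by
    apply exists_vecPoly_eq
    have h := degree_modByMonic_lt g (monic_X_pow_sub_C (1 : F) (NeZero.ne n))
    rwa [degree_X_pow_sub_C (NeZero.pos n), C_1] at h
  have hγe : ∀ x : E, x ^ n = 1 → aeval x (vecPoly F n γ) = aeval x g := by
    intro x hx
    have h := congrArg (aeval x) (modByMonic_add_div g (X ^ n - 1 : F[X]))
    rw [map_add, map_mul] at h
    rw [hγ, ← h]
    simp [hx]
  have hshift : ∀ k, (fun i => γ (i - k)) ∈ cyclicCode n g := by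
    intro k
    rw [mem_cyclicCode_iff hβ hg]
    intro r hr hr0
    have hx : (β ^ r) ^ n = 1 := by rw [← pow_mul, mul_comm, pow_mul, hβ.pow_eq_one, one_pow]
    rw [aeval_vecPoly_shift hx, hγe _ hx, hr0, mul_zero]
  have hdot : ∀ k, ∑ i, c i * γ (i - k) = 0 := fun k => hcd _ (hshift k)
  -- The coefficient of y^k in this product is the inner product of c with the k-th cyclic shift of
  -- γ, a codeword.
  have key : aeval y (vecPoly F n c) * aeval y⁻¹ (vecPoly F n γ) = 0 := by
    have h0 : y ≠ 0 := by
      rintro h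
      rw [h, zero_pow (NeZero.ne n)] at hy
      exact zero_ne_one hy
    calc aeval y (vecPoly F n c) * aeval y⁻¹ (vecPoly F n γ)
        = ∑ i, ∑ k : Fin n, algebraMap F E (c i * γ (i - k)) * y ^ (k : ℕ) := by
          rw [aeval_vecPoly, aeval_vecPoly, Finset.sum_mul]
          refine Finset.sum_congr rfl fun i _ => ?_
          rw [Finset.mul_sum, ← Equiv.sum_comp (Equiv.subLeft i)]
          refine Finset.sum_congr rfl fun k _ => ?_
          have h1 := pow_val_add hy (i - k) k
          rw [sub_add_cancel] at h1
          rw [Equiv.subLeft_apply, map_mul, h1, inv_pow]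
          have h2 : y ^ ((i - k : Fin n) : ℕ) ≠ 0 := pow_ne_zero _ h0
          field_simp
      _ = ∑ k : Fin n, algebraMap F E (∑ i, c i * γ (i - k)) * y ^ (k : ℕ) := by
          rw [Finset.sum_comm]
          refine Finset.sum_congr rfl fun k _ => ?_
          rw [map_sum, Finset.sum_mul]
      _ = 0 := Finset.sum_eq_zero fun k _ => by rw [hdot, map_zero, zero_mul]
  rw [hγe _ hyi] at key
  exact (mul_eq_zero.1 key).resolve_right hgi

end Cyclic

theorem le_minDist {F : Type*} [Field F] [DecidableEq F] {n : ℕ} {C : Submodule F (Fin n → F)}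
    {d : ℕ} (hC : 0 < Module.finrank F C) (h : ∀ c ∈ C, c ≠ 0 → d ≤ hammingNorm c) :
    d ≤ minDist C := by
  obtain ⟨⟨x, hx⟩, hx0⟩ := Module.finrank_pos_iff_exists_ne_zero.1 hC
  -- A nonzero codeword is required because `sInf ∅ = 0` on the zero code.
  refine le_csInf ⟨_, x, hx, 0, C.zero_mem, fun h => hx0 (Subtype.ext h), rfl⟩ ?_
  rintro _ ⟨x, hx, y, hy, hxy, rfl⟩
  rw [hammingDist_eq_hammingNorm]
  exact h _ (C.add_mem (C.neg_mem hx) hy) (by rw [neg_add_eq_sub, sub_ne_zero]; exact hxy.symm)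

end BCH

/-! ### BCH codes of length q ^ m + 1 -/

namespace BCH

open Polynomial

section BchCode

variable {F E : Type*} [Field F] [Field E] [Algebra F E]
  {q n m : ℕ} {β : E}

theorem isIntegral_pow_of_isPrimitiveRoot [NeZero n] (hβ : IsPrimitiveRoot β n) (j : ℕ) :
    IsIntegral F (β ^ j) := by
  refine IsIntegral.pow (IsIntegral.of_pow (NeZero.pos n) ?_) j
  rw [hβ.pow_eq_one]
  exact isIntegral_one

variable [DecidableEq F]

theorem genPoly_dvd (hβ : IsPrimitiveRoot β n) (δ b : ℕ) : genPoly F β δ b ∣ X ^ n - 1 := by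
  refine Finset.lcm_dvd fun j _ => minpoly.dvd F _ ?_
  simp only [map_sub, map_pow, aeval_X, map_one]
  rw [← pow_mul, mul_comm, pow_mul, hβ.pow_eq_one, one_pow, sub_self]

variable [Fintype F]

theorem aeval_genPoly_eq_zero_iff [NeZero n] (hF : Fintype.card F = q) (hβ : IsPrimitiveRoot β n)
    (δ b s : ℕ) : aeval (β ^ s) (genPoly F β δ b) = 0 ↔
      ∃ j < δ - 1, ∃ i : ℕ, (s : ZMod n) = ((b + j : ℕ) : ZMod n) * (q : ZMod n) ^ i := by
  have hroot : ∀ j, aeval (β ^ s) (minpoly F (β ^ (b + j))) = 0 ↔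
      ∃ i : ℕ, (s : ZMod n) = ((b + j : ℕ) : ZMod n) * (q : ZMod n) ^ i := by
    intro j
    rw [aeval_minpoly_eq_zero_iff (q := q) (by rw [Nat.card_eq_fintype_card, hF])
      (isIntegral_pow_of_isPrimitiveRoot hβ _)]
    refine exists_congr fun i => ?_
    have hmod : ∀ x y : ℕ, β ^ x = β ^ y ↔ (x : ZMod n) = y := by
      intro x y
      rw [ZMod.natCast_eq_natCast_iff', pow_eq_pow_mod x hβ.pow_eq_one,
        pow_eq_pow_mod y hβ.pow_eq_one]
      exact ⟨hβ.pow_inj (Nat.mod_lt _ (NeZero.pos n)) (Nat.mod_lt _ (NeZero.pos n)),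
        fun h => by rw [h]⟩
    rw [← pow_mul, hmod, Nat.cast_mul, Nat.cast_pow]
  constructor
  · intro h
    -- A root of the lcm is a root of the product, hence of some factor.
    have hdvd : genPoly F β δ b ∣ ∏ j ∈ Finset.range (δ - 1), minpoly F (β ^ (b + j)) :=
      Finset.lcm_dvd fun j hj => Finset.dvd_prod_of_mem _ hj
    obtain ⟨r, hr⟩ := hdvd
    have h1 := congrArg (aeval (β ^ s)) hr
    rw [map_mul, h, zero_mul, map_prod, Finset.prod_eq_zero_iff] at h1
    obtain ⟨j, hj, hj0⟩ := h1
    exact ⟨j, Finset.mem_range.1 hj, (hroot j).1 hj0⟩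
  · rintro ⟨j, hj, hi⟩
    obtain ⟨r, hr⟩ : minpoly F (β ^ (b + j)) ∣ genPoly F β δ b :=
      Finset.dvd_lcm (f := fun j => minpoly F (β ^ (b + j))) (Finset.mem_range.2 hj)
    rw [hr, map_mul, (hroot j).2 hi, zero_mul]

theorem isLCD_bchCode [NeZero n] (hF : Fintype.card F = q) (hβ : IsPrimitiveRoot β n)
    (hn : n = q ^ m + 1) (hm : (q : ZMod n) ^ m = -1) (δ b : ℕ) : IsLCD (bchCode F β n δ b) := by
  refine isLCD_cyclicCode hβ (genPoly_dvd hβ δ b) fun x hx h => ?_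
  obtain ⟨s, -, rfl⟩ := hβ.eq_pow_of_pow_eq_one hx
  have hinv : (β ^ s)⁻¹ = β ^ (s * q ^ m) := by
    rw [inv_eq_of_mul_eq_one_right]
    rw [pow_mul, ← pow_succ', ← hn, hx]
  rw [hinv, aeval_genPoly_eq_zero_iff hF hβ] at h
  obtain ⟨j, hj, i, hi⟩ := h
  rw [aeval_genPoly_eq_zero_iff hF hβ]
  refine ⟨j, hj, i + m, ?_⟩
  push_cast at hi ⊢
  rw [hm] at hi
  rw [pow_add, hm]
  linear_combination -hi

theorem le_hammingNorm_bchCode [NeZero n] (hF : Fintype.card F = q) (hβ : IsPrimitiveRoot β n)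
    {δ b : ℕ} {c : Fin n → F} (hc : c ∈ bchCode F β n δ b) (hc0 : c ≠ 0) :
    δ ≤ hammingNorm c := by
  have := lt_hammingNorm hβ hc0 (w := δ - 1) (b := b) fun j hj => by
    obtain ⟨r, hr⟩ := (mem_cyclicCode_iff_dvd (genPoly_dvd hβ δ b) c).1 hc
    rw [hr, map_mul, (aeval_genPoly_eq_zero_iff hF hβ δ b (b + j)).2 ⟨j, hj, 0, by simp⟩, zero_mul]
  omega

/-- The zeros of a BCH code starting at `β ^ 0` extend symmetrically to negative exponents. -/
theorem two_mul_le_hammingNorm_bchCode [NeZero n] (hF : Fintype.card F = q)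
    (hβ : IsPrimitiveRoot β n) (hm : (q : ZMod n) ^ m = -1) {δ : ℕ} (hδ : δ ≤ n) {c : Fin n → F}
    (hc : c ∈ bchCode F β n (δ + 1) 0) (hc0 : c ≠ 0) : 2 * δ ≤ hammingNorm c := by
  -- The run of exponents is -(δ-1), …, δ-1, shifted by n to stay in the natural numbers.
  have := lt_hammingNorm hβ hc0 (w := 2 * δ - 1) (b := n - (δ - 1)) fun j hj => by
    obtain ⟨r, hr⟩ := (mem_cyclicCode_iff_dvd (genPoly_dvd hβ (δ + 1) 0) c).1 hc
    rw [hr, map_mul, (aeval_genPoly_eq_zero_iff hF hβ (δ + 1) 0 _).2, zero_mul]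
    rcases lt_or_ge j (δ - 1) with h | h
    · refine ⟨δ - 1 - j, by omega, m, ?_⟩
      obtain ⟨k, hk⟩ : ∃ k, k = δ - 1 - j := ⟨_, rfl⟩
      rw [← hk, show n - (δ - 1) + j = n - k by omega, Nat.cast_sub (by omega), hm]
      simp
    · refine ⟨j - (δ - 1), by omega, 0, ?_⟩
      rw [show n - (δ - 1) + j = n + (j - (δ - 1)) by omega]
      simp
  omega

/-- A coset meets {0, …, δ-1} exactly when its leader is below δ. Starting at exponent 1 instead of
0 loses only the zero β^0, since {0} is a coset by itself. -/
theorem finrank_bchCode [NeZero n] (hF : Fintype.card F = q) (hβ : IsPrimitiveRoot β n)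
    (hq : IsUnit (q : ZMod n)) {δ : ℕ} (hδ1 : 1 ≤ δ) (hδ : δ ≤ n) :
    Module.finrank F (bchCode F β n δ 1) =
      ((Finset.range n).filter fun s => δ ≤ cosetLeader q n s).card + 1 ∧
    Module.finrank F (bchCode F β n (δ + 1) 0) =
      ((Finset.range n).filter fun s => δ ≤ cosetLeader q n s).card := by
  classical
  have hzero : ∀ s < n, (aeval (β ^ s) (genPoly F β (δ + 1) 0) = 0 ↔
      ¬ δ ≤ cosetLeader q n s) := by
    intro s hs
    simp only [aeval_genPoly_eq_zero_iff hF hβ, ← cosetLeader_eq_iff hq, not_le]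
    constructor
    · rintro ⟨j, hj, h⟩
      rw [h]
      exact lt_of_le_of_lt (cosetLeader_le_self hq (by omega)) (by omega)
    · intro h
      exact ⟨cosetLeader q n s, by omega, by rw [zero_add, cosetLeader_cosetLeader hq]⟩
  have hone : ∀ s < n, (aeval (β ^ s) (genPoly F β δ 1) = 0 ↔
      ¬ δ ≤ cosetLeader q n s ∧ s ≠ 0) := by
    intro s hs
    simp only [aeval_genPoly_eq_zero_iff hF hβ, ← cosetLeader_eq_iff hq, not_le,
      ← cosetLeader_eq_zero_iff hq hs, Ne]
    constructor
    · rintro ⟨j, hj, h⟩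
      rw [h, cosetLeader_eq_zero_iff hq (by omega)]
      exact ⟨lt_of_le_of_lt (cosetLeader_le_self hq (by omega)) (by omega), by omega⟩
    · rintro ⟨h, h0⟩
      exact ⟨cosetLeader q n s - 1, by omega, by
        rw [show 1 + (cosetLeader q n s - 1) = cosetLeader q n s by omega,
          cosetLeader_cosetLeader hq]⟩
  have hsplit := Finset.card_filter_add_card_filter_not (s := Finset.range n)
    (fun s => δ ≤ cosetLeader q n s)
  rw [Finset.card_range] at hsplit
  have h0 := finrank_cyclicCode (genPoly_dvd (F := F) hβ (δ + 1) 0)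
  have h1 := finrank_cyclicCode (genPoly_dvd (F := F) hβ δ 1)
  rw [natDegree_eq_card hβ (genPoly_dvd hβ _ _),
    Finset.filter_congr fun s hs => hzero s (Finset.mem_range.1 hs)] at h0
  rw [natDegree_eq_card hβ (genPoly_dvd hβ _ _),
    Finset.filter_congr fun s hs => hone s (Finset.mem_range.1 hs), ← Finset.filter_filter,
    Finset.filter_ne', Finset.card_erase_of_mem] at h1
  · have hpos : 0 < ((Finset.range n).filter fun s => ¬ δ ≤ cosetLeader q n s).card := by
      refine Finset.card_pos.2 ⟨0, Finset.mem_filter.2 ⟨Finset.mem_range.2 (NeZero.pos n), ?_⟩⟩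
      rw [(cosetLeader_eq_zero_iff hq (NeZero.pos n)).2 rfl]
      omega
    unfold bchCode
    omega
  · refine Finset.mem_filter.2 ⟨Finset.mem_range.2 (NeZero.pos n), ?_⟩
    rw [(cosetLeader_eq_zero_iff hq (NeZero.pos n)).2 rfl]
    omega

/-- Parameters of the two BCH codes in terms of the number of residues with large coset leader. -/
theorem isLCD_and_hasParams_bchCode [NeZero n] (hF : Fintype.card F = q) (hβ : IsPrimitiveRoot β n)
    (hq : IsUnit (q : ZMod n)) (hn : n = q ^ m + 1) (hm : (q : ZMod n) ^ m = -1) {δ d k : ℕ}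
    (hd : d < δ) (hδ : δ ≤ n)
    (hk : ((Finset.range n).filter fun s => δ ≤ cosetLeader q n s).card = k) (hk0 : 0 < k) :
    IsLCD (bchCode F β n δ 1) ∧ HasParams (bchCode F β n δ 1) (k + 1) d ∧
    IsLCD (bchCode F β n (δ + 1) 0) ∧ HasParams (bchCode F β n (δ + 1) 0) k (2 * d) := by
  obtain ⟨h1, h0⟩ := finrank_bchCode hF hβ hq (by omega) hδ
  rw [hk] at h1 h0
  refine ⟨isLCD_bchCode hF hβ hn hm _ _, ⟨h1, le_minDist (by omega) fun c hc hc0 => ?_⟩,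
    isLCD_bchCode hF hβ hn hm _ _, ⟨h0, le_minDist (by omega) fun c hc hc0 => ?_⟩⟩
  · exact hd.le.trans (le_hammingNorm_bchCode hF hβ hc hc0)
  · have := two_mul_le_hammingNorm_bchCode hF hβ hm hδ hc hc0
    omega

end BchCode

end BCH

/-! ### The main theorem -/

theorem theorem2 (q m t n : ℕ) (hq : Odd q) (hm : m = 4 * t + 2) (hn : n = q ^ m + 1)
    (F : Type*) [Field F] [Fintype F] [DecidableEq F] (hF : Fintype.card F = q)
    (E : Type*) [Field E] [Algebra F E] (β : E) (hβ : IsPrimitiveRoot β n) (δ : ℕ) :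
    (BCH.leader q n 3 < δ → δ ≤ BCH.leader q n 2 →
      BCH.IsLCD (BCH.bchCode F β n δ 1) ∧
      BCH.HasParams (BCH.bchCode F β n δ 1) 6 (BCH.leader q n 3) ∧
      BCH.IsLCD (BCH.bchCode F β n (δ + 1) 0) ∧
      BCH.HasParams (BCH.bchCode F β n (δ + 1) 0) 5 (2 * BCH.leader q n 3)) ∧
    (BCH.leader q n 4 < δ → δ ≤ BCH.leader q n 3 →
      BCH.IsLCD (BCH.bchCode F β n δ 1) ∧
      BCH.HasParams (BCH.bchCode F β n δ 1) (2 * m + 6) (BCH.leader q n 4) ∧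
      BCH.IsLCD (BCH.bchCode F β n (δ + 1) 0) ∧
      BCH.HasParams (BCH.bchCode F β n (δ + 1) 0) (2 * m + 5) (2 * BCH.leader q n 4)) := by
  have hq3 : 3 ≤ q := by
    have := Fintype.one_lt_card (α := F)
    obtain ⟨r, hr⟩ := hq
    omega
  have hn0 : NeZero n := ⟨by omega⟩
  have hm1 : (q : ZMod n) ^ m = -1 := by
    have : ((q ^ m + 1 : ℕ) : ZMod n) = 0 := by rw [← hn]; simp
    push_cast at this
    linear_combination this
  have hqu : IsUnit (q : ZMod n) := by
    refine IsUnit.of_mul_eq_one (-(q : ZMod n) ^ (4 * t + 1)) ?_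
    rw [hm, pow_succ] at hm1
    linear_combination -hm1
  obtain ⟨s₁, s₂, s₃, h₁, h₂, h₃, h₂₁, h₃₂, hmax, hp₁, hp₂, hp₃⟩ := BCH.topCosets hq3 hq hm hn
  obtain ⟨hA, hB⟩ := BCH.card_le_cosetLeader hqu h₁ h₂ h₃ h₂₁ h₃₂ hmax δ
  rw [hp₁, hp₂] at hA
  rw [hp₁, hp₂, hp₃] at hB
  have hle : ∀ i, BCH.leader q n i ≤ n := by
    intro i
    induction i with
    | zero => exact le_rfl
    | succ i ih =>
      rcases Nat.eq_zero_or_pos (BCH.leader q n i) with h | h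
      -- Once a leader is 0 no smaller one exists, and the supremum of the empty set is again 0.
      · rw [BCH.leader, h]
        simp
      · exact (BCH.leader_lt i h).le.trans ih
  refine ⟨fun hd hδ => ?_, fun hd hδ => ?_⟩
  · exact BCH.isLCD_and_hasParams_bchCode hF hβ hqu hn hm1 hd (hδ.trans (hle 2)) (hA hd hδ)
      (by norm_num)
  · have := BCH.isLCD_and_hasParams_bchCode hF hβ hqu hn hm1 hd (hδ.trans (hle 3)) (hB hd hδ)
      (by omega)
    rwa [show 1 + 4 + 2 * m = 2 * m + 5 by ring] at this
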